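/- Let $d\ge 1$ and $m,n\ge 0$ be integers, $\mathcal A=\mathbb Z[v,v^{-1}]$, $q=v^2$. Let $W$ be the Weyl group of type $B_d$, realized as the group of permutations $w$ of $\{-d,\dots,d\}$ with $w(-i)=-w(i)$, with length function $\ell$ with respect to the simple reflections $s_0=(-1,1)$ and $s_k=(k,k+1)(-k,-k-1)$, $1\le k<d$. Let $\mathcal H$ be its Hecke algebra over $\mathcal A$, generated by $T_{s_0},\dots,T_{s_{d-1}}$ subject to the braid relations of type $B_d$ and $(T_{s_k}+1)(T_{s_k}-q)=0$, with standard basis $(T_w)_{w\in W}$. For a weak composition $\lambda=(\lambda_0,\dots,\lambda_m\mid\lambda_{m+1},\dots,\lambda_{m+n})$ of $d$ put $\tilde\lambda_i=\lambda_0+\dots+\lambda_i$ and $|\lambda^{(1)}|=\lambda_{m+1}+\dots+\lambda_{m+n}$. Let $W_{\lambda^{(0)}}$ (resp. $W_{\lambda^{(1)}}$) be the subgroup of $W$ generated by the $s_k$ with $k\notin\{\tilde\lambda_0,\dots,\tilde\lambda_{m+n-1}\}$ and $k<\tilde\lambda_m$ (resp. $k>\tilde\lambda_m$), and let $$[xy]_\lambda=\Big(\sum_{w\in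 W_{\lambda^{(0)}}}T_w\Big)\Big(\sum_{w\in W_{\lambda^{(1)}}}(-q)^{-\ell(w)}T_w\Big)\in\mathcal H .$$ The $\imath$Schur superalgebra is $\mathcal S^{\jmath}_{m|n,d}=\operatorname{End}_{\mathcal H}\big(\bigoplus_\lambda[xy]_\lambda\mathcal H\big)$ (endomorphisms of right $\mathcal H$-modules, multiplied by composition), with the $\mathbb Z/2$-grading whose part of parity $p$ is $\bigoplus\operatorname{Hom}_{\mathcal H}([xy]_\lambda\mathcal H,[xy]_\mu\mathcal H)$ over the pairs $\lambda,\mu$ with $|\lambda^{(1)}|+|\mu^{(1)}|\equiv p \pmod 2$. Let $\mathbb I=\{-m-n,\dots,m+n\}$, and put $\widehat i=0$ if $|i|\le m$ and $\widehat i=1$ otherwise. Let $V_{m|n}$ be the free $\mathcal A$-module with basis $(e_i)_{i\in\mathbb I}$; the parity of $e_{i_1}\otimes\dots\otimes e_{i_d}$ in $V_{m|n}^{\otimes d}$ is $\widehat{i_1}+\dots+\widehat{i_d}$ modulo $2$. For $\mathbf i\in\mathbb I^d$ let $|\mathbf i|=\#\{k<l: i_k>i_l\}+\#\{k\le l: -i_k>i_l\}$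 (with $k,l\in\{1,\dots,d\}$) and $\mathbf e_{\mathbf i}=v^{|\mathbf i|}e_{i_1}\otimes\dots\otimes e_{i_d}$. Let $\mathbf i s_0=(-i_1,i_2,\dots,i_d)$, and let $\mathbf i s_k$ be $\mathbf i$ with $i_k$ and $i_{k+1}$ exchanged, for $1\le k<d$. Then $V_{m|n}^{\otimes d}$ is a right $\mathcal H$-module by $$\mathbf e_{\mathbf i}T_{s_k}=\begin{cases}(-1)^{\widehat{i_k}\widehat{i_{k+1}}}\mathbf e_{\mathbf is_k},& i_k<i_{k+1},\\ q\,\mathbf e_{\mathbf i},& i_k=i_{k+1},\ \widehat{i_k}=0,\\ -\mathbf e_{\mathbf i},& i_k=i_{k+1},\ \widehat{i_k}=1,\\ (-1)^{\widehat{i_k}\widehat{i_{k+1}}}q\,\mathbf e_{\mathbf is_k}+(q-1)\mathbf e_{\mathbf i},& i_k>i_{k+1},\end{cases}\qquad \mathbf e_{\mathbf i}T_{s_0}=\begin{cases}(-1)^{\widehat{i_1}}\mathbf e_{\mathbf is_0},& i_1>0,\\ q\,\mathbf e_{\mathbf i},& i_1=0,\\ (-1)^{\widehat{i_1}}q\,\mathbf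 e_{\mathbf is_0}+(q-1)\mathbf e_{\mathbf i},& i_1<0\end{cases}$$ for $1\le k<d$. Grade $\operatorname{End}_{\mathcal H}(V_{m|n}^{\otimes d})$ by letting the even (odd) endomorphisms be those that preserve (change) the parity. Then $\mathcal S^{\jmath}_{m|n,d}$ and $\operatorname{End}_{\mathcal H}(V_{m|n}^{\otimes d})$ with these gradings are superalgebras over $\mathcal A$ ($\mathbb Z/2$-graded algebras), and they are isomorphic as superalgebras: there is an isomorphism of $\mathcal A$-algebras $$\mathcal S^{\jmath}_{m|n,d}\;\cong\;\operatorname{End}_{\mathcal H}\big(V_{m|n}^{\otimes d}\big)$$ that maps the part of parity $p$ onto the part of parity $p$ for $p=0,1$. -/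

import Mathlib

open scoped TensorProduct DirectSum

namespace IotaSchur

/-! ### The ground ring `ℤ[v, v⁻¹]` and `q = v ^ 2` -/

/-- The ring `𝒜 = ℤ[v, v⁻¹]`. -/
abbrev Laurent : Type := LaurentPolynomial ℤ

/-- The indeterminate `v`, as a unit of `ℤ[v, v⁻¹]`. -/
noncomputable def vUnit : Laurentˣ where
  val := LaurentPolynomial.T 1
  inv := LaurentPolynomial.T (-1)
  val_inv := by rw [← LaurentPolynomial.T_add]; simp
  inv_val := by rw [← LaurentPolynomial.T_add]; simp

/-- `q = v ^ 2`, as a unit. -/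
noncomputable def qUnit : Laurentˣ := vUnit ^ 2

/-- `q = v ^ 2`, as an element of `ℤ[v, v⁻¹]`. -/
noncomputable def q : Laurent := (qUnit : Laurent)

/-! ### Symmetric intervals of integers -/

/-- The integral interval `[-N..N]`. -/
abbrev SymInt (N : ℕ) : Type := Set.Icc (-(N : ℤ)) (N : ℤ)

/-- The map `i ↦ -i` on `[-N..N]`. -/
def SymInt.neg {N : ℕ} (i : SymInt N) : SymInt N :=
  ⟨-(i : ℤ), by have := i.2; simp only [Set.mem_Icc] at this ⊢; omega⟩

@[simp] theorem SymInt.coe_neg {N : ℕ} (i : SymInt N) : ((SymInt.neg i : SymInt N) : ℤ) = -(i : ℤ) :=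
  rfl

theorem SymInt.neg_neg {N : ℕ} (i : SymInt N) : SymInt.neg (SymInt.neg i) = i := by
  apply Subtype.ext; simp

/-! ### The Weyl group of type `B_d` -/

/-- The Weyl group `W` of type `B_d`, as the group of the permutations `w` of `[-d..d]`
with `w (-i) = - w i`. -/
def weylGroup (d : ℕ) : Subgroup (Equiv.Perm (SymInt d)) where
  carrier := {w | ∀ i, w (SymInt.neg i) = SymInt.neg (w i)}
  one_mem' := by intro i; rfl
  mul_mem' := by
    intro a b ha hb i
    simp only [Set.mem_ofPred_eq] at ha hb
    rw [Equiv.Perm.mul_apply, Equiv.Perm.mul_apply, hb, ha]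
  inv_mem' := by
    intro a ha i
    simp only [Set.mem_ofPred_eq] at ha
    rw [Equiv.Perm.inv_eq_iff_eq, ha, ← Equiv.Perm.mul_apply, mul_inv_cancel, Equiv.Perm.one_apply]

noncomputable instance (d : ℕ) : Fintype (weylGroup d) := Fintype.ofFinite _

/-- The transposition of two integers of `[-d..d]`. -/
def transposition {d : ℕ} (a b : ℤ) (ha : a ∈ Set.Icc (-(d : ℤ)) (d : ℤ))
    (hb : b ∈ Set.Icc (-(d : ℤ)) (d : ℤ)) : Equiv.Perm (SymInt d) :=
  Equiv.swap ⟨a, ha⟩ ⟨b, hb⟩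

theorem coe_transposition {d : ℕ} (a b : ℤ) (ha : a ∈ Set.Icc (-(d : ℤ)) (d : ℤ))
    (hb : b ∈ Set.Icc (-(d : ℤ)) (d : ℤ)) (i : SymInt d) :
    ((transposition a b ha hb i : SymInt d) : ℤ)
      = if (i : ℤ) = a then b else if (i : ℤ) = b then a else (i : ℤ) := by
  simp only [transposition, Equiv.swap_apply_def, Subtype.ext_iff]
  split_ifs <;> rfl

/-- The simple reflections as permutations: `s_0 = (-1, 1)` and
`s_k = (k, k+1)(-k, -k-1)` for `1 ≤ k < d`. -/
def simplePerm {d : ℕ} (k : Fin d) : Equiv.Perm (SymInt d) :=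
  if (k : ℕ) = 0 then
    transposition (-1) 1
      (by have := k.2; simp only [Set.mem_Icc]; omega)
      (by have := k.2; simp only [Set.mem_Icc]; omega)
  else
    transposition (k : ℤ) ((k : ℤ) + 1)
      (by have := k.2; simp only [Set.mem_Icc]; omega)
      (by have := k.2; simp only [Set.mem_Icc]; omega) *
    transposition (-(k : ℤ)) (-(k : ℤ) - 1)
      (by have := k.2; simp only [Set.mem_Icc]; omega)
      (by have := k.2; simp only [Set.mem_Icc]; omega)

/-- The simple reflections `s_0, …, s_{d-1}` of `W`. -/
def simple {d : ℕ} (k : Fin d) : weylGroup d :=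
  ⟨simplePerm k, by
    intro i
    apply Subtype.ext
    unfold simplePerm
    split_ifs with h
    · simp only [coe_transposition, SymInt.coe_neg]
      split_ifs <;> omega
    · simp only [Equiv.Perm.mul_apply, coe_transposition, SymInt.coe_neg]
      split_ifs <;> omega⟩

/-- The length function of `W` with respect to the simple reflections. -/
noncomputable def len {d : ℕ} (w : weylGroup d) : ℕ :=
  sInf {r | ∃ l : List (Fin d), l.length = r ∧ (l.map simple).prod = w}

/-- `l` is a reduced word of `w`. -/
def IsReducedWord {d : ℕ} (w : weylGroup d) (l : List (Fin d)) : Prop :=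
  (l.map simple).prod = w ∧ l.length = len w

/-- A chosen reduced word of `w`; it exists because the simple reflections generate `W`. -/
noncomputable def reducedWord {d : ℕ} (w : weylGroup d) : List (Fin d) :=
  Classical.epsilon (IsReducedWord w)

/-! ### The Hecke algebra of type `B_d` -/

/-- The defining relations of the Hecke algebra: the quadratic relations and the braid
relations of type `B_d`. -/
inductive HeckeRel (d : ℕ) : FreeAlgebra Laurent (Fin d) → FreeAlgebra Laurent (Fin d) → Prop
  | quadratic (k : Fin d) :
      HeckeRel d ((FreeAlgebra.ι Laurent k + 1) *
        (FreeAlgebra.ι Laurent k - algebraMap Laurent _ q)) 0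
  | far (k l : Fin d) (h : (k : ℕ) + 1 < (l : ℕ)) :
      HeckeRel d (FreeAlgebra.ι Laurent k * FreeAlgebra.ι Laurent l)
        (FreeAlgebra.ι Laurent l * FreeAlgebra.ι Laurent k)
  | braidThree (k l : Fin d) (hk : (k : ℕ) ≠ 0) (h : (k : ℕ) + 1 = (l : ℕ)) :
      HeckeRel d
        (FreeAlgebra.ι Laurent k * FreeAlgebra.ι Laurent l * FreeAlgebra.ι Laurent k)
        (FreeAlgebra.ι Laurent l * FreeAlgebra.ι Laurent k * FreeAlgebra.ι Laurent l)
  | braidFour (k l : Fin d) (hk : (k : ℕ) = 0) (hl : (l : ℕ) = 1) :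
      HeckeRel d
        (FreeAlgebra.ι Laurent k * FreeAlgebra.ι Laurent l * FreeAlgebra.ι Laurent k *
          FreeAlgebra.ι Laurent l)
        (FreeAlgebra.ι Laurent l * FreeAlgebra.ι Laurent k * FreeAlgebra.ι Laurent l *
          FreeAlgebra.ι Laurent k)

/-- The Hecke algebra `ℋ` of type `B_d` over `ℤ[v, v⁻¹]` with parameter `q = v ^ 2`,
given by its generators `T_{s_0}, …, T_{s_{d-1}}` and the quadratic and braid relations. It is free
over `ℤ[v, v⁻¹]` with the basis of the elements `T_w`, `w ∈ W`, defined below. -/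
def Hecke (d : ℕ) : Type := RingQuot (HeckeRel d)

noncomputable instance (d : ℕ) : Ring (Hecke d) := inferInstanceAs (Ring (RingQuot (HeckeRel d)))

noncomputable instance (d : ℕ) : Algebra Laurent (Hecke d) :=
  inferInstanceAs (Algebra Laurent (RingQuot (HeckeRel d)))

/-- The generator `T_{s_k}` of the Hecke algebra. -/
noncomputable def heckeGen {d : ℕ} (k : Fin d) : Hecke d :=
  RingQuot.mkAlgHom Laurent (HeckeRel d) (FreeAlgebra.ι Laurent k)

/-- The basis element `T_w = T_{s_{k_1}} ⋯ T_{s_{k_r}}` of the Hecke algebra, where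
`w = s_{k_1} ⋯ s_{k_r}` is reduced; by the braid relations it does not depend on the
choice of the reduced word. -/
noncomputable def heckeT {d : ℕ} (w : weylGroup d) : Hecke d :=
  ((reducedWord w).map heckeGen).prod

/-! ### Compositions with parity, parabolic subgroups, the elements `[xy]_λ` -/

/-- The set `Λ(m|n, d)` of weak compositions `(λ_0, …, λ_m | λ_{m+1}, …, λ_{m+n})` of `d`. -/
abbrev Composition (m n d : ℕ) : Type := {c : Fin (m + n + 1) → ℕ // ∑ i, c i = d}

/-- The partial sum `λ_0 + ⋯ + λ_i`. -/
def partialSum {m n d : ℕ} (c : Composition m n d) (i : ℕ) : ℕ :=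
  ∑ j ∈ Finset.univ.filter (fun j : Fin (m + n + 1) => (j : ℕ) ≤ i), c.1 j

/-- The size `λ_{m+1} + ⋯ + λ_{m+n}` of the odd part of `λ`. -/
def oddSize {m n d : ℕ} (c : Composition m n d) : ℕ :=
  ∑ j ∈ Finset.univ.filter (fun j : Fin (m + n + 1) => m < (j : ℕ)), c.1 j

/-- `s_k` is one of the generators of `W_λ`, that is, `k` is none of the partial sums
`λ_0 + ⋯ + λ_i` with `0 ≤ i < m + n`. -/
def IsParabolicIndex {m n d : ℕ} (c : Composition m n d) (k : Fin d) : Prop :=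
  ∀ i : ℕ, i < m + n → (k : ℕ) ≠ partialSum c i

/-- The even part of the parabolic subgroup `W_λ`. -/
def evenParabolic {m n d : ℕ} (c : Composition m n d) : Subgroup (weylGroup d) :=
  Subgroup.closure {w | ∃ k : Fin d, IsParabolicIndex c k ∧ (k : ℕ) < partialSum c m ∧ simple k = w}

/-- The odd part of the parabolic subgroup `W_λ`. -/
def oddParabolic {m n d : ℕ} (c : Composition m n d) : Subgroup (weylGroup d) :=
  Subgroup.closure {w | ∃ k : Fin d, IsParabolicIndex c k ∧ partialSum c m < (k : ℕ) ∧ simple k = w}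

open Classical in
/-- The sum of the `T_w` over the even part of `W_λ`. -/
noncomputable def xElt {m n d : ℕ} (c : Composition m n d) : Hecke d :=
  ∑ w : weylGroup d with w ∈ evenParabolic c, heckeT w

open Classical in
/-- The sum of the `(-q)^{-ℓ(w)} T_w` over the odd part of `W_λ`. -/
noncomputable def yElt {m n d : ℕ} (c : Composition m n d) : Hecke d :=
  ∑ w : weylGroup d with w ∈ oddParabolic c,
    (((-qUnit) ^ (-(len w : ℤ)) : Laurentˣ) : Laurent) • heckeT w

/-- The element `[xy]_λ`. -/
noncomputable def xyElt {m n d : ℕ} (c : Composition m n d) : Hecke d := xElt c * yElt c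

/-! ### The `ι`-Schur superalgebra

Right `ℋ`-modules are modules over the opposite algebra `ℋᵐᵒᵖ`. -/

/-- The right ideal `[xy]_λ ℋ`. -/
noncomputable def xyIdeal {m n d : ℕ} (c : Composition m n d) : Submodule (Hecke d)ᵐᵒᵖ (Hecke d) :=
  Submodule.span (Hecke d)ᵐᵒᵖ {xyElt c}

/-- The right `ℋ`-module `⨁_λ [xy]_λ ℋ`. -/
abbrev PermModule (m n d : ℕ) : Type := ⨁ c : Composition m n d, xyIdeal c

/-- The `ι`-Schur superalgebra: the algebra of `ℋ`-linear endomorphisms of `⨁_λ [xy]_λ ℋ`,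
with the composition of maps as its multiplication. -/
abbrev SchurSuperalgebra (m n d : ℕ) : Type := Module.End (Hecke d)ᵐᵒᵖ (PermModule m n d)

/-- The `ℤ/2`-grading of the `ι`-Schur superalgebra: the piece of parity `p` is the sum of the
blocks `Hom_ℋ([xy]_λ ℋ, [xy]_μ ℋ)` with `|λ⁽¹⁾| + |μ⁽¹⁾| ≡ p` modulo `2`, that is, it consists
of the endomorphisms whose other blocks vanish. -/
def schurGrading (m n d : ℕ) (p : ZMod 2) : Submodule Laurent (SchurSuperalgebra m n d) where
  carrier := {f | ∀ c c' : Composition m n d, ((oddSize c + oddSize c' : ℕ) : ZMod 2) ≠ p →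
    ∀ x : xyIdeal c,
      (f (DirectSum.lof (Hecke d)ᵐᵒᵖ _ (fun c : Composition m n d => xyIdeal c) c x)) c' = 0}
  zero_mem' := by intro c c' _ x; simp
  add_mem' := by
    intro f g hf hg c c' h x
    rw [LinearMap.add_apply, DirectSum.add_apply, hf c c' h x, hg c c' h x, add_zero]
  smul_mem' := by
    intro a f hf c c' h x
    rw [LinearMap.smul_apply, DirectSum.smul_apply, hf c c' h x, smul_zero]

/-! ### The `q`-tensor superspace -/

/-- The index set `𝕀 = [-n-m..m+n]`. -/
abbrev Index (m n : ℕ) : Type := SymInt (m + n)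

/-- The parity of an index `i`: it is `0` if `-m ≤ i ≤ m` and `1` otherwise. -/
def hat {m n : ℕ} (i : Index m n) : ℕ := if |(i : ℤ)| ≤ (m : ℤ) then 0 else 1

/-- The free `ℤ[v, v⁻¹]`-module `V_{m|n}` with basis `(e_i)_{i ∈ 𝕀}`. -/
abbrev Superspace (m n : ℕ) : Type := Index m n →₀ Laurent

/-- The tensor power `V_{m|n}^{⊗ d}`. -/
def TensorSpace (m n d : ℕ) : Type := ⨂[Laurent] _ : Fin d, Superspace m n

noncomputable instance (m n d : ℕ) : AddCommGroup (TensorSpace m n d) :=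
  inferInstanceAs (AddCommGroup (⨂[Laurent] _ : Fin d, Superspace m n))

noncomputable instance (m n d : ℕ) : Module Laurent (TensorSpace m n d) :=
  inferInstanceAs (Module Laurent (⨂[Laurent] _ : Fin d, Superspace m n))

/-- The basis of the tensors `e_{i_1} ⊗ ⋯ ⊗ e_{i_d}`. The tensor factors are numbered by `Fin d`,
so that the `k`-th factor, `1 ≤ k ≤ d`, has the number `k - 1`. -/
noncomputable def tensorBasis (m n d : ℕ) :
    Module.Basis (Fin d → Index m n) Laurent (TensorSpace m n d) :=
  Basis.piTensorProduct (fun _ : Fin d => (Finsupp.basisSingleOne : Module.Basis _ Laurent _))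

/-- The length `|𝐢|` of a tuple of indices: the number of the pairs `k < l` with `i_k > i_l`
plus the number of the pairs `k ≤ l` with `-i_k > i_l`. -/
def tupleLength {m n d : ℕ} (i : Fin d → Index m n) : ℕ :=
  (Finset.univ.filter (fun p : Fin d × Fin d => p.1 < p.2 ∧ (i p.2 : ℤ) < i p.1)).card +
  (Finset.univ.filter (fun p : Fin d × Fin d => p.1 ≤ p.2 ∧ (i p.2 : ℤ) < -(i p.1 : ℤ))).card

/-- The basis of the rescaled tensors `v^{|𝐢|} e_{i_1} ⊗ ⋯ ⊗ e_{i_d}`. -/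
noncomputable def boldBasis (m n d : ℕ) :
    Module.Basis (Fin d → Index m n) Laurent (TensorSpace m n d) :=
  (tensorBasis m n d).unitsSMul (fun i => vUnit ^ tupleLength i)

/-- The number `k - 1`; for `k ≠ 0` the factors exchanged by `s_k` are those numbered
`k - 1` and `k`. -/
def prev {d : ℕ} (k : Fin d) : Fin d := ⟨(k : ℕ) - 1, by have := k.2; omega⟩

/-- The action of `s_k` on tuples: `s_0` changes the sign of the first entry and
`s_k` exchanges the entries `k` and `k + 1` if `1 ≤ k < d`. -/
def tupleAct {m n d : ℕ} (i : Fin d → Index m n) (k : Fin d) : Fin d → Index m n :=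
  if (k : ℕ) = 0 then Function.update i k (SymInt.neg (i k)) else i ∘ Equiv.swap (prev k) k

open Classical in
/-- The vector `𝐞_𝐢 · T_{s_k}`, where `𝐞_𝐢` is a vector of the rescaled basis. -/
noncomputable def genAct {m n d : ℕ} (k : Fin d) (i : Fin d → Index m n) : TensorSpace m n d :=
  if (k : ℕ) = 0 then
    if 0 < (i k : ℤ) then
      ((-1) ^ hat (i k) : Laurent) • boldBasis m n d (tupleAct i k)
    else if (i k : ℤ) = 0 then
      q • boldBasis m n d i
    else
      ((-1) ^ hat (i k) * q : Laurent) • boldBasis m n d (tupleAct i k)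
        + (q - 1) • boldBasis m n d i
  else
    if (i (prev k) : ℤ) < i k then
      ((-1) ^ (hat (i (prev k)) * hat (i k)) : Laurent) • boldBasis m n d (tupleAct i k)
    else if (i (prev k) : ℤ) = i k then
      (if hat (i k) = 0 then q else -1) • boldBasis m n d i
    else
      ((-1) ^ (hat (i (prev k)) * hat (i k)) * q : Laurent) • boldBasis m n d (tupleAct i k)
        + (q - 1) • boldBasis m n d i

/-- The right multiplication by `T_{s_k}` on `V_{m|n}^{⊗ d}`. -/
noncomputable def genOp (m n : ℕ) {d : ℕ} (k : Fin d) : Module.End Laurent (TensorSpace m n d) :=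
  (boldBasis m n d).constr Laurent (genAct k)

theorem genOp_apply {m n d : ℕ} (k : Fin d) (i : Fin d → Index m n) :
    genOp m n k (boldBasis m n d i) = genAct k i :=
  (boldBasis m n d).constr_basis Laurent _ _


/-! ### Braid relations for operators of the above shape -/

set_option maxHeartbeats 2000000 in
theorem braidThree_aux {R M J : Type*} [CommRing R] [AddCommGroup M] [Module R M]
    (q : R) (c : J → ℤ) (hc : Function.Injective c) (e : J → J → R) (t : J → R)
    (he : ∀ x y, e x y = e y x) (he2 : ∀ x y, e x y * e x y = 1)
    (ht : ∀ x, t x * t x = (q - 1) * t x + q) (P Q : M →ₗ[R] M) (g : J → J → J → M)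
    (hP : ∀ x y z, P (g x y z) =
      if c x < c y then e x y • g y x z
      else if c x = c y then t y • g x y z
      else (e x y * q) • g y x z + (q - 1) • g x y z)
    (hQ : ∀ x y z, Q (g x y z) =
      if c y < c z then e y z • g x z y
      else if c y = c z then t z • g x y z
      else (e y z * q) • g x z y + (q - 1) • g x y z)
    (x y z : J) : P (Q (P (g x y z))) = Q (P (Q (g x y z))) := by
  have P1 : ∀ x y z, c x < c y → P (g x y z) = e x y • g y x z := by
    intro x y z h; rw [hP, if_pos h]
  have P2 : ∀ x z, P (g x x z) = t x • g x x z := by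
    intro x z; rw [hP, if_neg (lt_irrefl _), if_pos rfl]
  have P3 : ∀ x y z, c x < c y → P (g y x z) = (e x y * q) • g x y z + (q - 1) • g y x z := by
    intro x y z h; rw [hP, if_neg h.not_gt, if_neg h.ne', he y x]
  have Q1 : ∀ x y z, c y < c z → Q (g x y z) = e y z • g x z y := by
    intro x y z h; rw [hQ, if_pos h]
  have Q2 : ∀ x z, Q (g x z z) = t z • g x z z := by
    intro x z; rw [hQ, if_neg (lt_irrefl _), if_pos rfl]
  have Q3 : ∀ x y z, c y < c z → Q (g x z y) = (e y z * q) • g x y z + (q - 1) • g x z y := by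
    intro x y z h; rw [hQ, if_neg h.not_gt, if_neg h.ne', he z y]
  clear hP hQ
  have e1 := he2 x y
  have e2 := he2 y z
  have e3 := he2 x z
  have f1 := he x y
  have f2 := he y z
  have f3 := he x z
  have t1 := ht x
  have t2 := ht y
  have t3 := ht z
  clear he he2 ht
  rcases lt_trichotomy (c x) (c y) with h1 | h1 | h1 <;>
  rcases lt_trichotomy (c y) (c z) with h2 | h2 | h2 <;>
  rcases lt_trichotomy (c x) (c z) with h3 | h3 | h3 <;>
  first
  | (exfalso; omega)
  | (try replace h1 := hc h1
     try replace h2 := hc h2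
     try replace h3 := hc h3
     subst_vars
     simp (disch := assumption) only [P1, P2, P3, Q1, Q2, Q3, map_add, map_smul] <;>
     (clear P1 P2 P3 Q1 Q2 Q3
      match_scalars <;> first | ring1 | grind))

set_option maxHeartbeats 2000000 in
theorem braidFour_aux {R M J : Type*} [CommRing R] [AddCommGroup M] [Module R M]
    (q : R) (c : J → ℤ) (hc : Function.Injective c) (n : J → J)
    (hn : ∀ x, c (n x) = - c x) (e : J → J → R) (t u : J → R)
    (he : ∀ x y, e x y = e y x) (he2 : ∀ x y, e x y * e x y = 1) (hen : ∀ x y, e (n x) y = e x y)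
    (ht : ∀ x, t x * t x = (q - 1) * t x + q) (htn : ∀ x, t (n x) = t x)
    (hu : ∀ x, u x * u x = 1) (hun : ∀ x, u (n x) = u x)
    (P Q : M →ₗ[R] M) (g : J → J → M)
    (hP : ∀ x y, P (g x y) =
      if 0 < c x then u x • g (n x) y
      else if c x = 0 then q • g x y
      else (u x * q) • g (n x) y + (q - 1) • g x y)
    (hQ : ∀ x y, Q (g x y) =
      if c x < c y then e x y • g y x
      else if c x = c y then t y • g x y
      else (e x y * q) • g y x + (q - 1) • g x y)
    (x y : J) : P (Q (P (Q (g x y)))) = Q (P (Q (P (g x y)))) := by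
  have hnn : ∀ x, n (n x) = x := fun x => hc (by rw [hn, hn, neg_neg])
  have P1 : ∀ x y, 0 < c x → P (g x y) = u x • g (n x) y := by
    intro x y h; rw [hP, if_pos h]
  have P2 : ∀ x y, c x = 0 → P (g x y) = q • g x y := by
    intro x y h; rw [hP, if_neg (by omega), if_pos h]
  have P3 : ∀ x y, c x < 0 → P (g x y) = (u x * q) • g (n x) y + (q - 1) • g x y := by
    intro x y h; rw [hP, if_neg (by omega), if_neg (by omega)]
  have Q1 : ∀ x y, c x < c y → Q (g x y) = e x y • g y x := by
    intro x y h; rw [hQ, if_pos h]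
  have Q2 : ∀ x, Q (g x x) = t x • g x x := by
    intro x; rw [hQ, if_neg (lt_irrefl _), if_pos rfl]
  have Q3 : ∀ x y, c y < c x → Q (g x y) = (e x y * q) • g y x + (q - 1) • g x y := by
    intro x y h; rw [hQ, if_neg (by omega), if_neg (by omega)]
  have hen' : ∀ x y, e x (n y) = e x y := fun x y => by rw [he, hen, he]
  have e1 := he2 x y
  have e2 := he2 x x
  have e3 := he2 y y
  have f1 := he x y
  have t1 := ht x
  have t2 := ht y
  have u1 := hu x
  have u2 := hu y
  clear he he2 ht hu
  have d1 := hn x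
  have d2 := hn y
  have d3 := hnn x
  have d4 := hnn y
  -- comparisons between the values of `±x`, `±y`
  rcases lt_trichotomy (c x) 0 with h1 | h1 | h1 <;>
  rcases lt_trichotomy (c y) 0 with h2 | h2 | h2 <;>
  rcases lt_trichotomy (c x) (c y) with h3 | h3 | h3 <;>
  rcases lt_trichotomy (c x) (-c y) with h4 | h4 | h4 <;>
  first
  | (exfalso; omega)
  | (try replace h3 := hc h3
     try replace h4 := hc (h4.trans (hn y).symm)
     subst_vars
     simp (disch := first | assumption | omega) only [P1, P2, P3, Q1, Q2, Q3, hnn,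
       hen, hen', htn, hun, map_add, map_smul] <;>
     (clear P1 P2 P3 Q1 Q2 Q3 hn hnn hen hen' htn hun
      match_scalars <;> first | ring1 | grind))

/-! ### The operators satisfy the defining relations of the Hecke algebra -/

/-- The sign `(-1)^(î ĵ)`. -/
noncomputable def sgn {m n : ℕ} (x y : Index m n) : Laurent := (-1) ^ (hat x * hat y)

/-- The scalar by which `T_{s_k}` acts if `i_k = i_{k+1}`: it is `q` in the even case and `-1` in
the odd case. -/
noncomputable def diagScalar {m n : ℕ} (x : Index m n) : Laurent := if hat x = 0 then q else -1

theorem hat_neg {m n : ℕ} (x : Index m n) : hat (SymInt.neg x) = hat x := by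
  simp [hat]

theorem sgn_comm {m n : ℕ} (x y : Index m n) : sgn x y = sgn y x := by
  simp [sgn, mul_comm]

theorem sgn_sq {m n : ℕ} (x y : Index m n) : sgn x y * sgn x y = 1 := by
  simp [sgn, ← mul_pow]

theorem diagScalar_sq {m n : ℕ} (x : Index m n) :
    diagScalar x * diagScalar x = (q - 1) * diagScalar x + q := by
  unfold diagScalar; split_ifs <;> ring

theorem genOp_zero {m n d : ℕ} (k : Fin d) (hk : (k : ℕ) = 0) (i : Fin d → Index m n) :
    genOp m n k (boldBasis m n d i) =
      if 0 < (i k : ℤ) then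
        ((-1) ^ hat (i k) : Laurent) • boldBasis m n d (Function.update i k (SymInt.neg (i k)))
      else if (i k : ℤ) = 0 then q • boldBasis m n d i
      else ((-1) ^ hat (i k) * q : Laurent) •
          boldBasis m n d (Function.update i k (SymInt.neg (i k)))
        + (q - 1) • boldBasis m n d i := by
  rw [genOp_apply, genAct, if_pos hk, tupleAct, if_pos hk]

theorem genOp_pos {m n d : ℕ} (k : Fin d) (hk : (k : ℕ) ≠ 0) (i : Fin d → Index m n) :
    genOp m n k (boldBasis m n d i) =
      if (i (prev k) : ℤ) < i k then
        sgn (i (prev k)) (i k) • boldBasis m n d (i ∘ Equiv.swap (prev k) k)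
      else if (i (prev k) : ℤ) = i k then diagScalar (i k) • boldBasis m n d i
      else (sgn (i (prev k)) (i k) * q) • boldBasis m n d (i ∘ Equiv.swap (prev k) k)
        + (q - 1) • boldBasis m n d i := by
  rw [genOp_apply, genAct, if_neg hk, tupleAct, if_neg hk]
  rfl

theorem coe_injective {m n : ℕ} : Function.Injective (fun x : Index m n => (x : ℤ)) :=
  Subtype.val_injective

theorem prev_ne {d : ℕ} (k : Fin d) (hk : (k : ℕ) ≠ 0) : prev k ≠ k := by
  intro h; have := congrArg Fin.val h; simp only [prev] at this; omega

theorem genOp_quadratic {m n d : ℕ} (k : Fin d) (x : TensorSpace m n d) :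
    genOp m n k (genOp m n k x) = (q - 1) • genOp m n k x + q • x := by
  suffices h : genOp m n k ∘ₗ genOp m n k = (q - 1) • genOp m n k + q • LinearMap.id from
    LinearMap.congr_fun h x
  refine (boldBasis m n d).ext fun i => ?_
  simp only [LinearMap.comp_apply, LinearMap.add_apply, LinearMap.smul_apply, LinearMap.id_apply]
  by_cases hk : (k : ℕ) = 0
  · have hs : ((-1) ^ hat (i k) * (-1) ^ hat (i k) : Laurent) = 1 := by simp [← mul_pow]
    have hu : Function.update (Function.update i k (SymInt.neg (i k))) k (i k) = i := by simp
    rw [genOp_zero k hk i]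
    rcases lt_trichotomy (0 : ℤ) (i k : ℤ) with h | h | h
    · simp only [if_pos h, map_smul]
      rw [genOp_zero k hk]
      simp only [Function.update_self, SymInt.coe_neg, SymInt.neg_neg,
        hat_neg, hu]
      rw [if_neg (by omega), if_neg (by omega)]
      match_scalars <;> grind
    · simp only [if_neg h.not_lt, if_pos h.symm, map_smul]
      rw [genOp_zero k hk i]
      simp only [if_neg h.not_lt, if_pos h.symm]
      match_scalars; ring
    · simp only [if_neg h.not_gt, if_neg h.ne, map_smul, map_add]
      rw [genOp_zero k hk, genOp_zero k hk i]
      simp only [Function.update_self, SymInt.coe_neg, SymInt.neg_neg,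
        hat_neg, hu]
      rw [if_pos (by omega), if_neg (by omega), if_neg (by omega)]
      match_scalars <;> grind
  · have hs := sgn_sq (i (prev k)) (i k)
    have ht := diagScalar_sq (i k)
    have hu : (i ∘ Equiv.swap (prev k) k) ∘ Equiv.swap (prev k) k = i := by
      funext j; simp
    have hc := sgn_comm (i (prev k)) (i k)
    rw [genOp_pos k hk i]
    rcases lt_trichotomy (i (prev k) : ℤ) (i k : ℤ) with h | h | h
    · simp only [if_pos h, map_smul]
      rw [genOp_pos k hk, hu]
      simp only [Function.comp_apply, Equiv.swap_apply_left, Equiv.swap_apply_right]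
      rw [if_neg (by omega), if_neg (by omega)]
      match_scalars <;> grind
    · simp only [if_neg h.not_lt, if_pos h, map_smul]
      rw [genOp_pos k hk i]
      simp only [if_neg h.not_lt, if_pos h]
      match_scalars; grind
    · simp only [if_neg h.not_gt, if_neg h.ne', map_smul, map_add]
      rw [genOp_pos k hk, genOp_pos k hk i, hu]
      simp only [Function.comp_apply, Equiv.swap_apply_left, Equiv.swap_apply_right]
      rw [if_pos (by omega), if_neg (by omega), if_neg (by omega)]
      match_scalars <;> grind

theorem genOp_far {m n d : ℕ} (k l : Fin d) (h : (k : ℕ) + 1 < (l : ℕ)) (x : TensorSpace m n d) :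
    genOp m n k (genOp m n l x) = genOp m n l (genOp m n k x) := by
  suffices h : genOp m n k ∘ₗ genOp m n l = genOp m n l ∘ₗ genOp m n k from
    LinearMap.congr_fun h x
  refine (boldBasis m n d).ext fun i => ?_
  simp only [LinearMap.comp_apply]
  have hl : (l : ℕ) ≠ 0 := by omega
  have n1 : prev l ≠ k := by
    intro h; have := congrArg Fin.val h; simp only [prev] at this; omega
  have n2 : l ≠ k := by rintro rfl; omega
  have n3 : prev l ≠ prev k := by
    intro h; have := congrArg Fin.val h; simp only [prev] at this; omega
  have n4 : l ≠ prev k := by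
    intro h; have := congrArg Fin.val h; simp only [prev] at this; omega
  by_cases hk : (k : ℕ) = 0
  · have a1 : ∀ y, Function.update i k y (prev l) = i (prev l) := fun y => by simp [n1]
    have a2 : ∀ y, Function.update i k y l = i l := fun y => by simp [n2]
    have a3 : (i ∘ Equiv.swap (prev l) l) k = i k := by
      simp [Equiv.swap_apply_of_ne_of_ne n1.symm n2.symm]
    have a4 : ∀ y, Function.update i k y ∘ Equiv.swap (prev l) l
        = Function.update (i ∘ Equiv.swap (prev l) l) k y := fun y => by
      rw [Function.update_comp_equiv, Equiv.symm_swap, Equiv.swap_apply_of_ne_of_ne n1.symm n2.symm]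
    rw [genOp_zero k hk i, genOp_pos l hl i]
    split_ifs <;>
    simp only [map_add, map_smul, genOp_zero k hk, genOp_pos l hl, *, if_true, if_false,
      lt_self_iff_false] <;>
    module
  · have a1 : (i ∘ Equiv.swap (prev k) k) (prev l) = i (prev l) := by
      simp [Equiv.swap_apply_of_ne_of_ne n3 n1]
    have a2 : (i ∘ Equiv.swap (prev k) k) l = i l := by
      simp [Equiv.swap_apply_of_ne_of_ne n4 n2]
    have a3 : (i ∘ Equiv.swap (prev l) l) k = i k := by
      simp [Equiv.swap_apply_of_ne_of_ne n1.symm n2.symm]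
    have a3' : (i ∘ Equiv.swap (prev l) l) (prev k) = i (prev k) := by
      simp [Equiv.swap_apply_of_ne_of_ne n3.symm n4.symm]
    have a4 : (i ∘ Equiv.swap (prev k) k) ∘ Equiv.swap (prev l) l
        = (i ∘ Equiv.swap (prev l) l) ∘ Equiv.swap (prev k) k := by
      have : Equiv.swap (prev k) k * Equiv.swap (prev l) l
          = Equiv.swap (prev l) l * Equiv.swap (prev k) k := by
        ext j
        simp only [Equiv.Perm.mul_apply, Equiv.swap_apply_def]
        split_ifs <;> simp_all
      funext j
      exact congrArg i (congrArg (fun f => f j) this)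
    rw [genOp_pos k hk i, genOp_pos l hl i]
    split_ifs <;>
    simp only [map_add, map_smul, genOp_pos k hk, genOp_pos l hl, *, if_true, if_false,
      lt_self_iff_false] <;>
    module

theorem genOp_braidThree {m n d : ℕ} (k l : Fin d) (hk : (k : ℕ) ≠ 0) (h : (k : ℕ) + 1 = (l : ℕ))
    (x : TensorSpace m n d) :
    genOp m n k (genOp m n l (genOp m n k x)) = genOp m n l (genOp m n k (genOp m n l x)) := by
  suffices h : genOp m n k ∘ₗ genOp m n l ∘ₗ genOp m n k
      = genOp m n l ∘ₗ genOp m n k ∘ₗ genOp m n l from LinearMap.congr_fun h x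
  refine (boldBasis m n d).ext fun i => ?_
  simp only [LinearMap.comp_apply]
  have hl : (l : ℕ) ≠ 0 := by omega
  have hp : prev l = k := Fin.ext (by simp only [prev]; omega)
  have n1 : prev k ≠ k := prev_ne k hk
  have n2 : k ≠ l := by rintro rfl; omega
  have n3 : prev k ≠ l := by
    intro h; have := congrArg Fin.val h; simp only [prev] at this; omega
  let u : Index m n → Index m n → Index m n → (Fin d → Index m n) := fun x y z =>
    Function.update (Function.update (Function.update i (prev k) x) k y) l z
  have u1 : ∀ x y z, u x y z (prev k) = x := fun x y z => by simp [u, n1, n3]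
  have u2 : ∀ x y z, u x y z k = y := fun x y z => by simp [u, n2]
  have u3 : ∀ x y z, u x y z l = z := fun x y z => by simp [u]
  have u4 : ∀ x y z j, j ≠ prev k → j ≠ k → j ≠ l → u x y z j = i j := fun x y z j h1 h2 h3 => by
    simp [u, h1, h2, h3]
  have s1 : ∀ x y z, u x y z ∘ Equiv.swap (prev k) k = u y x z := by
    intro x y z; funext j
    simp only [Function.comp_apply, Equiv.swap_apply_def]
    split_ifs with h1 h2
    · rw [h1, u2, u1]
    · rw [h2, u1, u2]
    · by_cases h3 : j = l
      · rw [h3, u3, u3]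
      · rw [u4 _ _ _ _ h1 h2 h3, u4 _ _ _ _ h1 h2 h3]
  have s2 : ∀ x y z, u x y z ∘ Equiv.swap k l = u x z y := by
    intro x y z; funext j
    simp only [Function.comp_apply, Equiv.swap_apply_def]
    split_ifs with h1 h2
    · rw [h1, u3, u2]
    · rw [h2, u2, u3]
    · by_cases h3 : j = prev k
      · rw [h3, u1, u1]
      · rw [u4 _ _ _ _ h3 h1 h2, u4 _ _ _ _ h3 h1 h2]
  have hi : i = u (i (prev k)) (i k) (i l) := by simp [u]
  rw [hi]
  refine braidThree_aux q (fun x : Index m n => (x : ℤ)) coe_injective sgn diagScalar sgn_comm sgn_sq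
    diagScalar_sq (genOp m n k) (genOp m n l) (fun x y z => boldBasis m n d (u x y z)) ?_ ?_ _ _ _
  · intro x y z
    simp only [genOp_pos k hk, u1, u2, s1]
  · intro x y z
    simp only [genOp_pos l hl, hp, u2, u3, s2]

theorem genOp_braidFour {m n d : ℕ} (k l : Fin d) (hk : (k : ℕ) = 0) (h : (l : ℕ) = 1)
    (x : TensorSpace m n d) :
    genOp m n k (genOp m n l (genOp m n k (genOp m n l x))) =
      genOp m n l (genOp m n k (genOp m n l (genOp m n k x))) := by
  suffices h : genOp m n k ∘ₗ genOp m n l ∘ₗ genOp m n k ∘ₗ genOp m n l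
      = genOp m n l ∘ₗ genOp m n k ∘ₗ genOp m n l ∘ₗ genOp m n k from LinearMap.congr_fun h x
  refine (boldBasis m n d).ext fun i => ?_
  simp only [LinearMap.comp_apply]
  have hl : (l : ℕ) ≠ 0 := by omega
  have hp : prev l = k := Fin.ext (by simp only [prev]; omega)
  have n2 : k ≠ l := by rintro rfl; omega
  let u : Index m n → Index m n → (Fin d → Index m n) := fun x y =>
    Function.update (Function.update i k x) l y
  have u2 : ∀ x y, u x y k = x := fun x y => by simp [u, n2]
  have u3 : ∀ x y, u x y l = y := fun x y => by simp [u]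
  have u4 : ∀ x y j, j ≠ k → j ≠ l → u x y j = i j := fun x y j h2 h3 => by
    simp [u, h2, h3]
  have s1 : ∀ x y z, Function.update (u x y) k z = u z y := by
    intro x y z
    simp only [u]
    rw [Function.update_comm n2, Function.update_idem, Function.update_comm n2]
  have s2 : ∀ x y, u x y ∘ Equiv.swap k l = u y x := by
    intro x y; funext j
    simp only [Function.comp_apply, Equiv.swap_apply_def]
    split_ifs with h1 h2
    · rw [h1, u3, u2]
    · rw [h2, u2, u3]
    · rw [u4 _ _ _ h1 h2, u4 _ _ _ h1 h2]
  have hi : i = u (i k) (i l) := by simp [u]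
  rw [hi]
  refine braidFour_aux q (fun x : Index m n => (x : ℤ)) coe_injective SymInt.neg (fun _ => rfl)
    sgn diagScalar (fun x => (-1) ^ hat x) sgn_comm sgn_sq ?_ diagScalar_sq ?_ ?_ ?_
    (genOp m n k) (genOp m n l) (fun x y => boldBasis m n d (u x y)) ?_ ?_ _ _
  · intro x y; simp only [sgn, hat_neg]
  · intro x; simp only [diagScalar, hat_neg]
  · intro x; simp [← mul_pow]
  · intro x; simp only [hat_neg]
  · intro x y
    simp only [genOp_zero k hk, u2, s1]
  · intro x y
    simp only [genOp_pos l hl, hp, u2, u3, s2]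

/-! ### The right `ℋ`-module `V_{m|n}^{⊗ d}` -/

theorem heckeAction_quadratic {m n d : ℕ} (k : Fin d) :
    FreeAlgebra.lift Laurent (fun k : Fin d => MulOpposite.op (genOp m n k))
      ((FreeAlgebra.ι Laurent k + 1) * (FreeAlgebra.ι Laurent k - algebraMap Laurent _ q)) =
    FreeAlgebra.lift Laurent (fun k : Fin d => MulOpposite.op (genOp m n k)) 0 := by
  rw [map_mul, map_add, map_sub, map_one, map_zero, AlgHom.commutes, FreeAlgebra.lift_ι_apply]
  apply MulOpposite.unop_injective
  refine LinearMap.ext fun x => ?_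
  rw [MulOpposite.unop_mul, Module.End.mul_apply]
  change genOp m n k (genOp m n k x + x) - q • (genOp m n k x + x) = 0
  rw [map_add, genOp_quadratic]
  module

/-- The right action of the Hecke algebra, as a homomorphism to the opposite of the algebra of
linear endomorphisms; it sends `T_{s_k}` to the operator `genOp m n k`. -/
noncomputable def heckeAction (m n d : ℕ) :
    Hecke d →ₐ[Laurent] (Module.End Laurent (TensorSpace m n d))ᵐᵒᵖ :=
  RingQuot.liftAlgHom Laurent
    ⟨FreeAlgebra.lift Laurent (fun k : Fin d => MulOpposite.op (genOp m n k)), by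
      intro a b hab
      induction hab with
      | quadratic k => exact heckeAction_quadratic k
      | far k l h =>
        simp only [map_mul, FreeAlgebra.lift_ι_apply, ← MulOpposite.op_mul]
        exact congrArg MulOpposite.op (LinearMap.ext fun x => (genOp_far k l h x).symm)
      | braidThree k l hk h =>
        simp only [map_mul, FreeAlgebra.lift_ι_apply, ← MulOpposite.op_mul]
        exact congrArg MulOpposite.op (LinearMap.ext fun x => genOp_braidThree k l hk h x)
      | braidFour k l hk h =>
        simp only [map_mul, FreeAlgebra.lift_ι_apply, ← MulOpposite.op_mul]
        exact congrArg MulOpposite.op (LinearMap.ext fun x => (genOp_braidFour k l hk h x).symm)⟩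

theorem heckeAction_heckeGen {m n d : ℕ} (k : Fin d) :
    heckeAction m n d (heckeGen k) = MulOpposite.op (genOp m n k) := by
  rw [heckeAction, heckeGen]
  erw [RingQuot.liftAlgHom_mkAlgHom_apply]
  rw [FreeAlgebra.lift_ι_apply]

/-- The right `ℋ`-module structure of `V_{m|n}^{⊗ d}`. -/
noncomputable instance (m n d : ℕ) : Module (Hecke d)ᵐᵒᵖ (TensorSpace m n d) :=
  Module.compHom (TensorSpace m n d) (AlgHom.opComm (heckeAction m n d)).toRingHom

theorem op_smul_def {m n d : ℕ} (h : Hecke d) (x : TensorSpace m n d) :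
    MulOpposite.op h • x = (heckeAction m n d h).unop x := rfl

/-- The formula for `𝐞_𝐢 · T_{s_k}`. -/
theorem op_heckeGen_smul_boldBasis {m n d : ℕ} (k : Fin d) (i : Fin d → Index m n) :
    MulOpposite.op (heckeGen k) • boldBasis m n d i = genAct k i := by
  rw [op_smul_def, heckeAction_heckeGen, MulOpposite.unop_op, genOp_apply]

instance (m n d : ℕ) : SMulCommClass (Hecke d)ᵐᵒᵖ Laurent (TensorSpace m n d) where
  smul_comm h a x := map_smul (heckeAction m n d h.unop).unop a x

instance (m n d : ℕ) : IsScalarTower Laurent (Hecke d)ᵐᵒᵖ (TensorSpace m n d) where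
  smul_assoc a h x := by
    induction h using MulOpposite.rec' with
    | h h =>
      rw [← MulOpposite.op_smul, op_smul_def, op_smul_def, map_smul]
      rfl

/-- The algebra of the `ℋ`-linear endomorphisms of `V_{m|n}^{⊗ d}`. -/
abbrev TensorEnd (m n d : ℕ) : Type := Module.End (Hecke d)ᵐᵒᵖ (TensorSpace m n d)

/-- The `ℤ/2`-grading of `V_{m|n}^{⊗ d}`: the parity of `e_{i_1} ⊗ ⋯ ⊗ e_{i_d}` is the sum of
the parities of `i_1, …, i_d`. -/
noncomputable def tensorGrading (m n d : ℕ) (p : ZMod 2) : Submodule Laurent (TensorSpace m n d) :=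
  Submodule.span Laurent {x | ∃ i : Fin d → Index m n,
    ((∑ k, hat (i k) : ℕ) : ZMod 2) = p ∧ tensorBasis m n d i = x}

/-- The `ℤ/2`-grading of `End_ℋ(V_{m|n}^{⊗ d})`: the even endomorphisms preserve the parity and
the odd ones change it. -/
def tensorEndGrading (m n d : ℕ) (p : ZMod 2) : Submodule Laurent (TensorEnd m n d) where
  carrier := {f | ∀ r : ZMod 2, ∀ x ∈ tensorGrading m n d r, f x ∈ tensorGrading m n d (r + p)}
  zero_mem' := fun _ _ _ => Submodule.zero_mem _
  add_mem' := fun hf hg r x hx => Submodule.add_mem _ (hf r x hx) (hg r x hx)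
  smul_mem' := fun a _ hf r x hx => Submodule.smul_mem _ a (hf r x hx)

end IotaSchur

/-!
The two algebras are the endomorphism algebras of two isomorphic right `ℋ`-modules,
`⨁_λ [xy]_λ ℋ` and `V_{m|n}^{⊗ d}`, and the isomorphism respects the parities.

The generators of `ℋ` compare two neighbours in `(-i_1, i_1, …, i_d)`; removing descents one by one
leads from any tuple to a dominant one, `0 ≤ i_1 ≤ ⋯ ≤ i_d`, and the dominant tuples correspond to
the compositions `λ`. The basic tool is the universal property `exists_heckeHom`: `V_{m|n}^{⊗ d}` is
the sum of the `ℋ`-modules generated by the vectors `𝐞_{𝐢_λ}`, `𝐢_λ` dominant, subject only to the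
relations `𝐞_{𝐢_λ} T_{s_k} = q 𝐞_{𝐢_λ}` or `-𝐞_{𝐢_λ}` for the `s_k ∈ W_λ`. It is proved like
Matsumoto's theorem: the value at a tuple is defined by removing a descent, and the braid relations
make the choice irrelevant (`descentRule_confluent`, `fixedRule_of_descent`).

Applied to `V_{d|0}^{⊗ d}` and the tuples `(w 1, …, w d)`, the universal property also gives the
facts needed about `ℋ`. With the target `ℋ`, it shows that `h ↦ 𝐞_{(1, …, d)} h` is injective
(`op_smul_regTuple_one_injective`). With a target on which every generator acts by `q`, it shows
that the number of ascents on a path from `1` to `w` depends on `w` only (`exists_ascent_length`), so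
that this number is the length. Together they give `T_w T_{s_k} = T_{w s_k}` at ascents, whence
`[xy]_λ T_{s_k} = q [xy]_λ` or `-[xy]_λ` for `s_k ∈ W_λ`.

So there is a homomorphism `V_{m|n}^{⊗ d} → ⨁_λ [xy]_λ ℋ`, `𝐞_{𝐢_λ} ↦ [xy]_λ`, clearly surjective.
Its composite with the map `h ↦ 𝐞_{𝐢_λ} h` on the summands multiplies `𝐞_{𝐢_λ}` by the scalar by
which `[xy]_λ` acts on it. The specialization of this scalar at `v = 1` is the order of
`W_{λ⁽⁰⁾}` times that of `W_{λ⁽¹⁾}`, so it is nonzero; since the tensor space is free over a domain,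
the homomorphism is injective (`exists_permModule_equiv`). Finally, both gradings come from a
decomposition of the module into an even and an odd part, that is, from a complete family of
orthogonal idempotents of the endomorphism ring (`nonempty_gradedAlgebra`), and the isomorphism
carries one family to the other because simple reflections do not change the composition of a tuple.
-/

namespace IotaSchur

/-! ### Tuples and the simple reflections -/

/-- The entry that precedes `i_k` in `(-i_1, i_1, …, i_d)` when `T_{s_k}` compares two entries:
`-i_1` for `s_0`, and the left one of the two exchanged entries otherwise. With this convention
all generators act by the same formula. -/
def leftEntry {m n d : ℕ} (i : Fin d → Index m n) (k : Fin d) : Index m n :=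
  if (k : ℕ) = 0 then SymInt.neg (i k) else i (prev k)

section Tuples

variable {m n d : ℕ}

theorem leftEntry_zero {k : Fin d} (hk : (k : ℕ) = 0) (i : Fin d → Index m n) :
    leftEntry i k = SymInt.neg (i k) := if_pos hk

theorem leftEntry_pos {k : Fin d} (hk : (k : ℕ) ≠ 0) (i : Fin d → Index m n) :
    leftEntry i k = i (prev k) := if_neg hk

theorem tupleAct_zero {k : Fin d} (hk : (k : ℕ) = 0) (i : Fin d → Index m n) :
    tupleAct i k = Function.update i k (SymInt.neg (i k)) := if_pos hk

theorem tupleAct_pos {k : Fin d} (hk : (k : ℕ) ≠ 0) (i : Fin d → Index m n) :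
    tupleAct i k = i ∘ Equiv.swap (prev k) k := if_neg hk

theorem tupleAct_apply_self (i : Fin d → Index m n) (k : Fin d) :
    tupleAct i k k = leftEntry i k := by
  unfold tupleAct leftEntry
  split_ifs <;> simp

theorem leftEntry_tupleAct (i : Fin d → Index m n) (k : Fin d) :
    leftEntry (tupleAct i k) k = i k := by
  unfold tupleAct leftEntry
  split_ifs <;> simp [SymInt.neg_neg]

theorem tupleAct_tupleAct (i : Fin d → Index m n) (k : Fin d) :
    tupleAct (tupleAct i k) k = i := by
  unfold tupleAct
  split_ifs
  · simp [SymInt.neg_neg]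
  · funext j; simp

/-- The reflections `s_k`, `s_l` with `k + 1 < l` move disjoint sets of entries. -/
theorem tupleAct_far (i : Fin d → Index m n) {k l : Fin d} (h : (k : ℕ) + 1 < l) :
    leftEntry (tupleAct i k) l = leftEntry i l ∧ tupleAct i k l = i l ∧
    leftEntry (tupleAct i l) k = leftEntry i k ∧ tupleAct i l k = i k ∧
    tupleAct (tupleAct i k) l = tupleAct (tupleAct i l) k := by
  have hl : (l : ℕ) ≠ 0 := by omega
  have n1 : k ≠ l := by rintro rfl; omega
  have n2 : k ≠ prev l := by
    intro h'; have := congrArg Fin.val h'; simp only [prev] at this; omega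
  have n3 : prev k ≠ l := by
    intro h'; have := congrArg Fin.val h'; simp only [prev] at this; omega
  have n4 : prev k ≠ prev l := by
    intro h'; have := congrArg Fin.val h'; simp only [prev] at this; omega
  simp only [leftEntry, tupleAct, if_neg hl]
  by_cases hk : (k : ℕ) = 0
  · simp only [if_pos hk]
    refine ⟨by simp [n2.symm], by simp [n1.symm],
      by simp [Equiv.swap_apply_of_ne_of_ne n2 n1], by simp [Equiv.swap_apply_of_ne_of_ne n2 n1], ?_⟩
    funext j
    simp only [Function.comp_apply, Function.update_apply, Equiv.swap_apply_def]
    split_ifs <;> simp_all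
  · simp only [if_neg hk]
    refine ⟨by simp [Equiv.swap_apply_of_ne_of_ne n4.symm n2.symm],
      by simp [Equiv.swap_apply_of_ne_of_ne n3.symm n1.symm],
      by simp [Equiv.swap_apply_of_ne_of_ne n4 n3], by simp [Equiv.swap_apply_of_ne_of_ne n2 n1], ?_⟩
    funext j
    simp only [Function.comp_apply, Equiv.swap_apply_def]
    split_ifs <;> simp_all

/-- All generators act on the rescaled basis by one formula in terms of `leftEntry`. -/
theorem genOp_boldBasis (k : Fin d) (i : Fin d → Index m n) :
    genOp m n k (boldBasis m n d i) =
      if (leftEntry i k : ℤ) < i k then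
        sgn (leftEntry i k) (i k) • boldBasis m n d (tupleAct i k)
      else if (leftEntry i k : ℤ) = i k then diagScalar (i k) • boldBasis m n d i
      else (sgn (leftEntry i k) (i k) * q) • boldBasis m n d (tupleAct i k)
        + (q - 1) • boldBasis m n d i := by
  by_cases hk : (k : ℕ) = 0
  · have hs : sgn (leftEntry i k) (i k) = (-1) ^ hat (i k) := by
      rw [leftEntry_zero hk, sgn, hat_neg]
      unfold hat
      split_ifs <;> simp
    rw [genOp_zero k hk, hs, leftEntry_zero hk, tupleAct_zero hk, SymInt.coe_neg]
    by_cases h1 : 0 < (i k : ℤ)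
    · rw [if_pos h1, if_pos (show -(i k : ℤ) < i k by omega)]
    · rw [if_neg h1, if_neg (show ¬ -(i k : ℤ) < i k by omega)]
      by_cases h2 : (i k : ℤ) = 0
      · rw [if_pos h2, if_pos (show -(i k : ℤ) = i k by omega)]
        simp [diagScalar, hat, h2]
      · rw [if_neg h2, if_neg (show ¬ -(i k : ℤ) = i k by omega)]
  · rw [genOp_pos k hk, leftEntry_pos hk, tupleAct_pos hk]

theorem heckeGen_smul_of_lt {k : Fin d} {i : Fin d → Index m n} (h : (leftEntry i k : ℤ) < i k) :
    MulOpposite.op (heckeGen k) • boldBasis m n d i =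
      sgn (leftEntry i k) (i k) • boldBasis m n d (tupleAct i k) := by
  rw [op_heckeGen_smul_boldBasis, ← genOp_apply, genOp_boldBasis, if_pos h]

theorem heckeGen_smul_of_eq {k : Fin d} {i : Fin d → Index m n} (h : leftEntry i k = i k) :
    MulOpposite.op (heckeGen k) • boldBasis m n d i = diagScalar (i k) • boldBasis m n d i := by
  rw [op_heckeGen_smul_boldBasis, ← genOp_apply, genOp_boldBasis, if_neg (by simp [h]),
    if_pos (by simp [h])]

/-- A tuple is dominant if `0 ≤ i_1 ≤ ⋯ ≤ i_d`. -/
def IsDominant (i : Fin d → Index m n) : Prop := ∀ k, (leftEntry i k : ℤ) ≤ i k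

/-- A weighted sum of the entries of a tuple, which drops whenever a simple reflection removes a
descent; it serves as the measure of all inductions over tuples. -/
def weight (i : Fin d → Index m n) : ℕ := ∑ j : Fin d, ((j : ℕ) + 1) * ((m + n : ℤ) - i j).toNat

theorem weight_tupleAct_lt {i : Fin d → Index m n} {k : Fin d} (h : (i k : ℤ) < leftEntry i k) :
    weight (tupleAct i k) < weight i := by
  by_cases hk : (k : ℕ) = 0
  · rw [leftEntry_zero hk, SymInt.coe_neg] at h
    rw [tupleAct_zero hk]
    have hb := (i k).2
    simp only [Set.mem_Icc] at hb
    refine Finset.sum_lt_sum (fun j _ => ?_) ⟨k, Finset.mem_univ _, ?_⟩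
    · by_cases hj : j = k
      · subst hj
        rw [Function.update_self, SymInt.coe_neg]
        gcongr
        omega
      · rw [Function.update_of_ne hj]
    · rw [Function.update_self, SymInt.coe_neg]
      gcongr
      omega
  · rw [leftEntry_pos hk] at h
    rw [tupleAct_pos hk]
    have hne := prev_ne k hk
    unfold weight
    have hmem : prev k ∈ Finset.univ.erase k := by simp [hne]
    rw [← Finset.add_sum_erase _ _ (Finset.mem_univ k), ← Finset.add_sum_erase _ _ hmem,
      ← Finset.add_sum_erase _ _ (Finset.mem_univ k), ← Finset.add_sum_erase _ _ hmem]
    have hrest : ∑ j ∈ (Finset.univ.erase k).erase (prev k),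
          ((j : ℕ) + 1) * ((m + n : ℤ) - (i ∘ Equiv.swap (prev k) k) j).toNat
        = ∑ j ∈ (Finset.univ.erase k).erase (prev k),
          ((j : ℕ) + 1) * ((m + n : ℤ) - i j).toNat := by
      refine Finset.sum_congr rfl fun j hj => ?_
      simp only [Finset.mem_erase] at hj
      rw [Function.comp_apply, Equiv.swap_apply_of_ne_of_ne hj.1 hj.2.1]
    rw [hrest]
    simp only [Function.comp_apply, Equiv.swap_apply_left, Equiv.swap_apply_right]
    have hb := (i k).2
    have hb' := (i (prev k)).2
    simp only [Set.mem_Icc] at hb hb'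
    push_cast at hb hb'
    obtain ⟨x, hx⟩ : ∃ x : ℕ, ((m + n : ℤ) - i k).toNat = x := ⟨_, rfl⟩
    obtain ⟨y, hy⟩ : ∃ y : ℕ, ((m + n : ℤ) - i (prev k)).toNat = y := ⟨_, rfl⟩
    have hxy : y < x := by omega
    have hpk : ((prev k : Fin d) : ℕ) + 1 = k := by simp only [prev]; omega
    rw [hx, hy, hpk]
    nlinarith

/-- Induction over tuples: every tuple is reached from a dominant one by raising reflections. -/
theorem tuple_induction {p : (Fin d → Index m n) → Prop}
    (dominant : ∀ i, IsDominant i → p i)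
    (step : ∀ i k, (i k : ℤ) < leftEntry i k → p (tupleAct i k) → p i) (i) : p i := by
  induction h : weight i using Nat.strong_induction_on generalizing i with
  | _ N ih =>
    by_cases hi : IsDominant i
    · exact dominant i hi
    · simp only [IsDominant, not_forall, not_le] at hi
      obtain ⟨k, hk⟩ := hi
      exact step i k hk (ih _ (h ▸ weight_tupleAct_lt hk) _ rfl)

/-- At a descent of `𝐢`, the vector `𝐞_𝐢` is obtained from a tuple without this descent. -/
theorem boldBasis_eq_of_gt {k : Fin d} {i : Fin d → Index m n} (h : (i k : ℤ) < leftEntry i k) :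
    boldBasis m n d i = sgn (leftEntry i k) (i k) •
      MulOpposite.op (heckeGen k) • boldBasis m n d (tupleAct i k) := by
  rw [heckeGen_smul_of_lt (by rwa [leftEntry_tupleAct, tupleAct_apply_self]), leftEntry_tupleAct,
    tupleAct_apply_self, tupleAct_tupleAct, smul_smul, sgn_comm (i k), sgn_sq, one_smul]

end Tuples

/-! ### Right modules over the Hecke algebra -/

section Hecke

variable {d : ℕ}

theorem heckeGen_mul_self (k : Fin d) :
    heckeGen k * heckeGen k = (q - 1) • heckeGen k + q • (1 : Hecke d) := by
  have h := RingQuot.mkAlgHom_rel Laurent (HeckeRel.quadratic k)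
  simp only [map_mul, map_add, map_sub, map_one, map_zero, AlgHom.commutes] at h
  change (heckeGen k + 1) * (heckeGen k - algebraMap Laurent (Hecke d) q) = 0 at h
  rw [Algebra.algebraMap_eq_smul_one, add_mul, mul_sub, one_mul, mul_smul_comm, mul_one] at h
  rw [← sub_eq_zero, ← h]
  module

theorem heckeGen_far {k l : Fin d} (h : (k : ℕ) + 1 < l) :
    heckeGen k * heckeGen l = heckeGen l * heckeGen k := by
  have h := RingQuot.mkAlgHom_rel Laurent (HeckeRel.far k l h)
  simp only [map_mul] at h
  exact h

theorem heckeGen_braidThree {k l : Fin d} (hk : (k : ℕ) ≠ 0) (h : (k : ℕ) + 1 = l) :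
    heckeGen k * heckeGen l * heckeGen k = heckeGen l * heckeGen k * heckeGen l := by
  have h := RingQuot.mkAlgHom_rel Laurent (HeckeRel.braidThree k l hk h)
  simp only [map_mul] at h
  exact h

theorem heckeGen_braidFour {k l : Fin d} (hk : (k : ℕ) = 0) (h : (l : ℕ) = 1) :
    heckeGen k * heckeGen l * heckeGen k * heckeGen l =
      heckeGen l * heckeGen k * heckeGen l * heckeGen k := by
  have h := RingQuot.mkAlgHom_rel Laurent (HeckeRel.braidFour k l hk h)
  simp only [map_mul] at h
  exact h

/-- `T_{s_k}` is invertible, with the inverse `q⁻¹ (T_{s_k} - (q - 1))`. -/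
theorem isUnit_heckeGen (k : Fin d) : IsUnit (heckeGen k) := by
  have hq : ((qUnit⁻¹ : Laurentˣ) : Laurent) * q = 1 := qUnit.inv_mul
  refine isUnit_iff_exists.mpr
    ⟨((qUnit⁻¹ : Laurentˣ) : Laurent) • (heckeGen k - (q - 1) • 1), ?_, ?_⟩
  · rw [mul_smul_comm, mul_sub, heckeGen_mul_self, mul_smul_comm, mul_one, add_sub_cancel_left,
      smul_smul, hq, one_smul]
  · rw [smul_mul_assoc, sub_mul, heckeGen_mul_self, smul_mul_assoc, one_mul, add_sub_cancel_left,
      smul_smul, hq, one_smul]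

variable {N : Type*} [AddCommGroup N] [Module Laurent N] [Module (Hecke d)ᵐᵒᵖ N]
  [IsScalarTower Laurent (Hecke d)ᵐᵒᵖ N]

variable (N) in
/-- The right multiplication by `T_{s_k}` on a right `ℋ`-module. -/
noncomputable def rightGen (k : Fin d) : N →ₗ[Laurent] N :=
  Algebra.lsmul Laurent Laurent N (MulOpposite.op (heckeGen k))

theorem rightGen_apply (k : Fin d) (x : N) :
    rightGen N k x = MulOpposite.op (heckeGen k) • x := rfl

theorem rightGen_rightGen (k : Fin d) (x : N) :
    rightGen N k (rightGen N k x) = (q - 1) • rightGen N k x + q • x := by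
  simp only [rightGen_apply, smul_smul, ← MulOpposite.op_mul, heckeGen_mul_self]
  rw [MulOpposite.op_add, add_smul, MulOpposite.op_smul, MulOpposite.op_smul, smul_assoc,
    smul_assoc, MulOpposite.op_one, one_smul]

theorem rightGen_far {k l : Fin d} (h : (k : ℕ) + 1 < l) (x : N) :
    rightGen N k (rightGen N l x) = rightGen N l (rightGen N k x) := by
  simp only [rightGen_apply, smul_smul, ← MulOpposite.op_mul, heckeGen_far h]

theorem rightGen_braidThree {k l : Fin d} (hk : (k : ℕ) ≠ 0) (h : (k : ℕ) + 1 = l) (x : N) :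
    rightGen N k (rightGen N l (rightGen N k x)) =
      rightGen N l (rightGen N k (rightGen N l x)) := by
  simp only [rightGen_apply, smul_smul, ← MulOpposite.op_mul]
  rw [heckeGen_braidThree hk h]

theorem rightGen_braidFour {k l : Fin d} (hk : (k : ℕ) = 0) (h : (l : ℕ) = 1) (x : N) :
    rightGen N k (rightGen N l (rightGen N k (rightGen N l x))) =
      rightGen N l (rightGen N k (rightGen N l (rightGen N k x))) := by
  simp only [rightGen_apply, smul_smul, ← MulOpposite.op_mul]
  rw [heckeGen_braidFour hk h]

/-- A submodule stable under the generators `T_{s_k}` is stable under `ℋ`. -/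
theorem op_smul_mem_of_gen (S : Submodule Laurent N)
    (hS : ∀ k : Fin d, ∀ x ∈ S, MulOpposite.op (heckeGen k) • x ∈ S) (h : Hecke d) :
    ∀ x ∈ S, MulOpposite.op h • x ∈ S := by
  obtain ⟨a, rfl⟩ := RingQuot.mkAlgHom_surjective Laurent (HeckeRel d) h
  induction a using FreeAlgebra.induction with
  | grade0 r =>
    intro x hx
    rw [AlgHom.commutes]
    change MulOpposite.op (algebraMap Laurent (Hecke d) r) • x ∈ S
    rw [Algebra.algebraMap_eq_smul_one, MulOpposite.op_smul, smul_assoc, MulOpposite.op_one,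
      one_smul]
    exact S.smul_mem r hx
  | grade1 k => exact hS k
  | mul a b ha hb =>
    intro x hx
    rw [map_mul]
    erw [MulOpposite.op_mul, mul_smul]
    exact hb _ (ha x hx)
  | add a b ha hb =>
    intro x hx
    rw [map_add]
    erw [MulOpposite.op_add, add_smul]
    exact S.add_mem (ha x hx) (hb x hx)

variable {N' : Type*} [AddCommGroup N'] [Module Laurent N'] [Module (Hecke d)ᵐᵒᵖ N']
  [IsScalarTower Laurent (Hecke d)ᵐᵒᵖ N']

/-- A linear map that commutes with the generators `T_{s_k}` is `ℋ`-linear. -/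
noncomputable def heckeHom (f : N →ₗ[Laurent] N')
    (hf : ∀ (k : Fin d) x, f (MulOpposite.op (heckeGen k) • x) = MulOpposite.op (heckeGen k) • f x) :
    N →ₗ[(Hecke d)ᵐᵒᵖ] N' where
  toFun := f
  map_add' := map_add f
  map_smul' h x := by
    -- the graph of `f` is stable under the generators
    have := op_smul_mem_of_gen (N := N × N') f.graph (fun k x hx => by
      rw [LinearMap.mem_graph_iff] at hx ⊢
      rw [Prod.smul_fst, Prod.smul_snd, hf, hx]) h.unop (x, f x) (by simp)
    rw [LinearMap.mem_graph_iff] at this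
    exact this.symm

end Hecke

/-! ### The universal property of the tensor space -/

section RankTwo

variable {m n d : ℕ}

/-- The entries that `s_k` and `s_{k+1}` move, `k ≠ 0`, as three independent variables. -/
theorem exists_three_entries (i : Fin d → Index m n) {k l : Fin d} (hk : (k : ℕ) ≠ 0)
    (h : (k : ℕ) + 1 = l) :
    ∃ u : Index m n → Index m n → Index m n → (Fin d → Index m n),
      u (leftEntry i k) (i k) (i l) = i ∧ ∀ x y z,
        leftEntry (u x y z) k = x ∧ u x y z k = y ∧ leftEntry (u x y z) l = y ∧ u x y z l = z ∧
        tupleAct (u x y z) k = u y x z ∧ tupleAct (u x y z) l = u x z y := by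
  have hl : (l : ℕ) ≠ 0 := by omega
  have hp : prev l = k := Fin.ext (by simp only [prev]; omega)
  have n1 : prev k ≠ k := prev_ne k hk
  have n2 : k ≠ l := by rintro rfl; omega
  have n3 : prev k ≠ l := by
    intro h; have := congrArg Fin.val h; simp only [prev] at this; omega
  let u : Index m n → Index m n → Index m n → (Fin d → Index m n) := fun x y z =>
    Function.update (Function.update (Function.update i (prev k) x) k y) l z
  have u1 : ∀ x y z, u x y z (prev k) = x := fun x y z => by simp [u, n1, n3]
  have u2 : ∀ x y z, u x y z k = y := fun x y z => by simp [u, n2]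
  have u3 : ∀ x y z, u x y z l = z := fun x y z => by simp [u]
  have u4 : ∀ x y z j, j ≠ prev k → j ≠ k → j ≠ l → u x y z j = i j := fun x y z j h1 h2 h3 => by
    simp [u, h1, h2, h3]
  refine ⟨u, by simp [u, leftEntry_pos hk], fun x y z => ⟨by rw [leftEntry_pos hk, u1], u2 _ _ _,
    by rw [leftEntry_pos hl, hp, u2], u3 _ _ _, ?_, ?_⟩⟩
  · rw [tupleAct_pos hk]
    funext j
    simp only [Function.comp_apply, Equiv.swap_apply_def]
    split_ifs with h1 h2
    · rw [h1, u2, u1]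
    · rw [h2, u1, u2]
    · by_cases h3 : j = l
      · rw [h3, u3, u3]
      · rw [u4 _ _ _ _ h1 h2 h3, u4 _ _ _ _ h1 h2 h3]
  · rw [tupleAct_pos hl, hp]
    funext j
    simp only [Function.comp_apply, Equiv.swap_apply_def]
    split_ifs with h1 h2
    · rw [h1, u3, u2]
    · rw [h2, u2, u3]
    · by_cases h3 : j = prev k
      · rw [h3, u1, u1]
      · rw [u4 _ _ _ _ h3 h1 h2, u4 _ _ _ _ h3 h1 h2]

/-- The entries that `s_0` and `s_1` move, as two independent variables. -/
theorem exists_two_entries (i : Fin d → Index m n) {k l : Fin d} (hk : (k : ℕ) = 0)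
    (h : (l : ℕ) = 1) :
    ∃ u : Index m n → Index m n → (Fin d → Index m n),
      u (i k) (i l) = i ∧ ∀ x y,
        leftEntry (u x y) k = SymInt.neg x ∧ u x y k = x ∧ leftEntry (u x y) l = x ∧
        u x y l = y ∧ tupleAct (u x y) k = u (SymInt.neg x) y ∧ tupleAct (u x y) l = u y x := by
  have hl : (l : ℕ) ≠ 0 := by omega
  have hp : prev l = k := Fin.ext (by simp only [prev]; omega)
  have n2 : k ≠ l := by rintro rfl; omega
  let u : Index m n → Index m n → (Fin d → Index m n) := fun x y =>
    Function.update (Function.update i k x) l y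
  have u2 : ∀ x y, u x y k = x := fun x y => by simp [u, n2]
  have u3 : ∀ x y, u x y l = y := fun x y => by simp [u]
  have u4 : ∀ x y j, j ≠ k → j ≠ l → u x y j = i j := fun x y j h2 h3 => by
    simp [u, h2, h3]
  refine ⟨u, by simp [u], fun x y => ⟨by rw [leftEntry_zero hk, u2], u2 _ _,
    by rw [leftEntry_pos hl, hp, u2], u3 _ _, ?_, ?_⟩⟩
  · rw [tupleAct_zero hk, u2]
    simp only [u]
    rw [Function.update_comm n2, Function.update_idem, Function.update_comm n2]
  · rw [tupleAct_pos hl, hp]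
    funext j
    simp only [Function.comp_apply, Equiv.swap_apply_def]
    split_ifs with h1 h2
    · rw [h1, u3, u2]
    · rw [h2, u2, u3]
    · rw [u4 _ _ _ h1 h2, u4 _ _ _ h1 h2]

theorem sgn_neg_left (x y : Index m n) : sgn (SymInt.neg x) y = sgn x y := by
  simp only [sgn, hat_neg]

theorem sgn_neg_right (x y : Index m n) : sgn x (SymInt.neg y) = sgn x y := by
  simp only [sgn, hat_neg]

end RankTwo

section Extension

variable {m n d : ℕ} {N : Type*} [AddCommGroup N] [Module Laurent N] [Module (Hecke d)ᵐᵒᵖ N]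
  [IsScalarTower Laurent (Hecke d)ᵐᵒᵖ N]

/-- The family `g` in a right `ℋ`-module satisfies at `𝐢` the relations of the vectors `𝐞_𝐢` that
express `g 𝐢` through the tuples obtained by removing a descent. -/
def DescentRule (g : (Fin d → Index m n) → N) (i : Fin d → Index m n) : Prop :=
  ∀ k, (i k : ℤ) < leftEntry i k →
    g i = sgn (leftEntry i k) (i k) • rightGen N k (g (tupleAct i k))

/-- The family `g` in a right `ℋ`-module satisfies at `𝐢` the relations of the vectors `𝐞_𝐢` for
the reflections that fix `𝐢`. -/
def FixedRule (g : (Fin d → Index m n) → N) (i : Fin d → Index m n) : Prop :=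
  ∀ k, leftEntry i k = i k → rightGen N k (g i) = diagScalar (i k) • g i

variable {g : (Fin d → Index m n) → N} {i : Fin d → Index m n}

/-- Confluence for two descents: removing either of them leads to the same vector. The rank two
cases are those of the three kinds of braid relations. -/
theorem descentRule_confluent (hD : ∀ j, weight j < weight i → DescentRule g j) {k l : Fin d}
    (hkl : (k : ℕ) < l) (hk : (i k : ℤ) < leftEntry i k) (hl : (i l : ℤ) < leftEntry i l) :
    sgn (leftEntry i k) (i k) • rightGen N k (g (tupleAct i k)) =
      sgn (leftEntry i l) (i l) • rightGen N l (g (tupleAct i l)) := by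
  by_cases hfar : (k : ℕ) + 1 < l
  · obtain ⟨f1, f2, f3, f4, f5⟩ := tupleAct_far i hfar
    have e1 := hD _ (weight_tupleAct_lt hk) l (by rwa [f1, f2])
    have e2 := hD _ (weight_tupleAct_lt hl) k (by rwa [f3, f4])
    rw [e1, e2, f1, f2, f3, f4, f5, map_smul, map_smul, rightGen_far hfar]
    module
  have h : (k : ℕ) + 1 = l := by omega
  by_cases hk0 : (k : ℕ) = 0
  · obtain ⟨u, hu, hu'⟩ := exists_two_entries i hk0 (l := l) (by omega)
    have rk : ∀ x y, weight (u x y) < weight i → (x : ℤ) < -(x : ℤ) →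
        g (u x y) = sgn x x • rightGen N k (g (u (SymInt.neg x) y)) := by
      intro x y hw hlt
      obtain ⟨h1, h2, h3, h4, h5, h6⟩ := hu' x y
      have := hD _ hw k (by rwa [h1, h2])
      rwa [h1, h2, h5, sgn_neg_left] at this
    have rl : ∀ x y, weight (u x y) < weight i → (y : ℤ) < x →
        g (u x y) = sgn x y • rightGen N l (g (u y x)) := by
      intro x y hw hlt
      obtain ⟨h1, h2, h3, h4, h5, h6⟩ := hu' x y
      have := hD _ hw l (by rwa [h3, h4])
      rwa [h3, h4, h6] at this
    have wk : ∀ x y : Index m n, (x : ℤ) < -(x : ℤ) →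
        weight (u (SymInt.neg x) y) < weight (u x y) := by
      intro x y hlt
      obtain ⟨h1, h2, h3, h4, h5, h6⟩ := hu' x y
      rw [← h5]
      exact weight_tupleAct_lt (by rwa [h1, h2])
    have wl : ∀ x y : Index m n, (y : ℤ) < x → weight (u y x) < weight (u x y) := by
      intro x y hlt
      obtain ⟨h1, h2, h3, h4, h5, h6⟩ := hu' x y
      rw [← h6]
      exact weight_tupleAct_lt (by rwa [h3, h4])
    obtain ⟨h1, h2, h3, h4, h5, h6⟩ := hu' (i k) (i l)
    rw [hu] at h1 h2 h3 h4 h5 h6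
    rw [h1, SymInt.coe_neg] at hk
    rw [h3] at hl
    rw [h1, h3, h5, h6]
    rw [← hu] at rk rl
    generalize i k = x at *
    generalize i l = y at *
    have w1 := wk x y hk
    have w2 := wl (SymInt.neg x) y (by rw [SymInt.coe_neg]; omega)
    have w3 := wk y (SymInt.neg x) (by omega)
    have w1' := wl x y hl
    have w2' := wk y x (by omega)
    have w3' := wl (SymInt.neg y) x (by rw [SymInt.coe_neg]; omega)
    rw [rl (SymInt.neg x) y w1 (by rw [SymInt.coe_neg]; omega),
      rk y (SymInt.neg x) (by omega) (by omega),
      rl (SymInt.neg y) (SymInt.neg x) (by omega) (by simp only [SymInt.coe_neg]; omega),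
      rk y x w1' (by omega), rl (SymInt.neg y) x (by omega) (by rw [SymInt.coe_neg]; omega),
      rk x (SymInt.neg y) (by omega) (by omega)]
    simp only [map_smul, rightGen_braidFour hk0 (show (l : ℕ) = 1 by omega), sgn_neg_left,
      sgn_neg_right, sgn_comm y x]
    module
  · obtain ⟨u, hu, hu'⟩ := exists_three_entries i hk0 h
    have rk : ∀ x y z, weight (u x y z) < weight i → (y : ℤ) < x →
        g (u x y z) = sgn x y • rightGen N k (g (u y x z)) := by
      intro x y z hw hlt
      obtain ⟨h1, h2, h3, h4, h5, h6⟩ := hu' x y z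
      have := hD _ hw k (by rwa [h1, h2])
      rwa [h1, h2, h5] at this
    have rl : ∀ x y z, weight (u x y z) < weight i → (z : ℤ) < y →
        g (u x y z) = sgn y z • rightGen N l (g (u x z y)) := by
      intro x y z hw hlt
      obtain ⟨h1, h2, h3, h4, h5, h6⟩ := hu' x y z
      have := hD _ hw l (by rwa [h3, h4])
      rwa [h3, h4, h6] at this
    have wk : ∀ x y z : Index m n, (y : ℤ) < x → weight (u y x z) < weight (u x y z) := by
      intro x y z hlt
      obtain ⟨h1, h2, h3, h4, h5, h6⟩ := hu' x y z
      rw [← h5]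
      exact weight_tupleAct_lt (by rwa [h1, h2])
    have wl : ∀ x y z : Index m n, (z : ℤ) < y → weight (u x z y) < weight (u x y z) := by
      intro x y z hlt
      obtain ⟨h1, h2, h3, h4, h5, h6⟩ := hu' x y z
      rw [← h6]
      exact weight_tupleAct_lt (by rwa [h3, h4])
    obtain ⟨h1, h2, h3, h4, h5, h6⟩ := hu' (leftEntry i k) (i k) (i l)
    rw [hu] at h1 h2 h3 h4 h5 h6
    rw [h3] at hl
    rw [h3, h5, h6]
    rw [← hu] at rk rl
    generalize leftEntry i k = x at *
    generalize i k = y at *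
    generalize i l = z at *
    have w1 := wk x y z hk
    have w2 := wl y x z (by omega)
    have w1' := wl x y z hl
    have w2' := wk x z y (by omega)
    rw [rl y x z w1 (by omega), rk y z x (by omega) (by omega),
      rk x z y w1' (by omega), rl z x y (by omega) (by omega)]
    simp only [map_smul, rightGen_braidThree hk0 h]
    module

/-- Confluence for a descent at `l` of a tuple fixed by `s_k`. -/
theorem fixedRule_of_descent (hD : ∀ j, weight j ≤ weight i → DescentRule g j)
    (hX : ∀ j, weight j < weight i → FixedRule g j) {k l : Fin d}
    (hk : leftEntry i k = i k) (hl : (i l : ℤ) < leftEntry i l) :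
    rightGen N k (g i) = diagScalar (i k) • g i := by
  have hne : k ≠ l := by rintro rfl; rw [hk] at hl; omega
  have hwl := weight_tupleAct_lt hl
  by_cases hfar : (k : ℕ) + 1 < l ∨ (l : ℕ) + 1 < k
  · have key : leftEntry (tupleAct i l) k = leftEntry i k ∧ tupleAct i l k = i k := by
      rcases hfar with h | h
      · obtain ⟨f1, f2, f3, f4, f5⟩ := tupleAct_far i h
        exact ⟨f3, f4⟩
      · obtain ⟨f1, f2, f3, f4, f5⟩ := tupleAct_far i h
        exact ⟨f1, f2⟩
    have e := hX _ hwl k (by rw [key.1, key.2, hk])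
    have hc : ∀ x : N, rightGen N k (rightGen N l x) = rightGen N l (rightGen N k x) := by
      rcases hfar with h | h
      · exact rightGen_far h
      · exact fun x => (rightGen_far h x).symm
    rw [hD i le_rfl l hl, map_smul, hc, e, key.2, map_smul, smul_comm]
  by_cases h0 : (k : ℕ) = 0 ∨ (l : ℕ) = 0
  · -- the roles of `s_0` and `s_1`
    obtain ⟨a, b, ha, hb, hab⟩ : ∃ a b : Fin d, (a : ℕ) = 0 ∧ (b : ℕ) = 1 ∧
        ((k = a ∧ l = b) ∨ (k = b ∧ l = a)) := by
      have hne' : (k : ℕ) ≠ l := fun h => hne (Fin.ext h)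
      rcases h0 with h | h
      · exact ⟨k, l, h, by omega, Or.inl ⟨rfl, rfl⟩⟩
      · exact ⟨l, k, h, by omega, Or.inr ⟨rfl, rfl⟩⟩
    obtain ⟨u, hu, hu'⟩ := exists_two_entries i ha hb
    have ra : ∀ x y, weight (u x y) ≤ weight i → (x : ℤ) < -(x : ℤ) →
        g (u x y) = sgn x x • rightGen N a (g (u (SymInt.neg x) y)) := by
      intro x y hw hlt
      obtain ⟨h1, h2, h3, h4, h5, h6⟩ := hu' x y
      have := hD _ hw a (by rwa [h1, h2])
      rwa [h1, h2, h5, sgn_neg_left] at this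
    have rb : ∀ x y, weight (u x y) ≤ weight i → (y : ℤ) < x →
        g (u x y) = sgn x y • rightGen N b (g (u y x)) := by
      intro x y hw hlt
      obtain ⟨h1, h2, h3, h4, h5, h6⟩ := hu' x y
      have := hD _ hw b (by rwa [h3, h4])
      rwa [h3, h4, h6] at this
    have wa : ∀ x y : Index m n, (x : ℤ) < -(x : ℤ) →
        weight (u (SymInt.neg x) y) < weight (u x y) := by
      intro x y hlt
      obtain ⟨h1, h2, h3, h4, h5, h6⟩ := hu' x y
      rw [← h5]
      exact weight_tupleAct_lt (by rwa [h1, h2])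
    have wb : ∀ x y : Index m n, (y : ℤ) < x → weight (u y x) < weight (u x y) := by
      intro x y hlt
      obtain ⟨h1, h2, h3, h4, h5, h6⟩ := hu' x y
      rw [← h6]
      exact weight_tupleAct_lt (by rwa [h3, h4])
    have xa : ∀ x y, weight (u x y) < weight i → (x : ℤ) = 0 →
        rightGen N a (g (u x y)) = diagScalar x • g (u x y) := by
      intro x y hw hx
      obtain ⟨h1, h2, h3, h4, h5, h6⟩ := hu' x y
      have := hX _ hw a (by rw [h1, h2]; ext; rw [SymInt.coe_neg]; omega)
      rwa [h2] at this
    have xb : ∀ x, weight (u x x) < weight i →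
        rightGen N b (g (u x x)) = diagScalar x • g (u x x) := by
      intro x hw
      obtain ⟨h1, h2, h3, h4, h5, h6⟩ := hu' x x
      have := hX _ hw b (by rw [h3, h4])
      rwa [h4] at this
    obtain ⟨h1, h2, h3, h4, h5, h6⟩ := hu' (i a) (i b)
    rw [hu] at h1 h2 h3 h4 h5 h6
    rw [← hu] at ra rb xa xb
    rcases hab with ⟨rfl, rfl⟩ | ⟨rfl, rfl⟩
    · -- `(0, y)` with `y < 0`
      have hx : (i k : ℤ) = 0 := by
        have := congrArg Subtype.val (h1.symm.trans hk); simp only [SymInt.coe_neg] at this; omega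
      rw [h3] at hl
      rw [← hu]
      simp only [hu' _ _]
      generalize i k = x at *
      generalize i l = y at *
      have w1 := wb x y hl
      have w2 := wa y x (by omega)
      have w3 := wb (SymInt.neg y) x (by rw [SymInt.coe_neg]; omega)
      rw [rb x y le_rfl hl, ra y x (by omega) (by omega),
        rb (SymInt.neg y) x (by omega) (by rw [SymInt.coe_neg]; omega)]
      simp only [map_smul, rightGen_braidFour ha hb]
      rw [xa x (SymInt.neg y) (by omega) hx]
      simp only [map_smul]
      module
    · -- `(x, x)` with `x < 0`
      have hx : i l = i k := h3.symm.trans hk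
      rw [h1, SymInt.coe_neg] at hl
      rw [← hu]
      simp only [hu' _ _]
      generalize i l = x at *
      generalize i k = y at *
      subst hx
      have w1 := wa x x hl
      have w2 := wb (SymInt.neg x) x (by rw [SymInt.coe_neg]; omega)
      have w3 := wa x (SymInt.neg x) (by omega)
      rw [ra x x le_rfl hl, rb (SymInt.neg x) x (by omega) (by rw [SymInt.coe_neg]; omega),
        ra x (SymInt.neg x) (by omega) (by omega)]
      simp only [map_smul, ← rightGen_braidFour ha hb]
      rw [xb (SymInt.neg x) (by omega)]
      simp only [map_smul, diagScalar, hat_neg]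
      module
  · obtain ⟨a, b, ha, hb, hab⟩ : ∃ a b : Fin d, (a : ℕ) ≠ 0 ∧ (a : ℕ) + 1 = b ∧
        ((k = a ∧ l = b) ∨ (k = b ∧ l = a)) := by
      have hne' : (k : ℕ) ≠ l := fun h => hne (Fin.ext h)
      rcases Nat.lt_or_gt_of_ne hne' with h | h
      · exact ⟨k, l, by omega, by omega, Or.inl ⟨rfl, rfl⟩⟩
      · exact ⟨l, k, by omega, by omega, Or.inr ⟨rfl, rfl⟩⟩
    obtain ⟨u, hu, hu'⟩ := exists_three_entries i ha hb
    have ra : ∀ x y z, weight (u x y z) ≤ weight i → (y : ℤ) < x →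
        g (u x y z) = sgn x y • rightGen N a (g (u y x z)) := by
      intro x y z hw hlt
      obtain ⟨h1, h2, h3, h4, h5, h6⟩ := hu' x y z
      have := hD _ hw a (by rwa [h1, h2])
      rwa [h1, h2, h5] at this
    have rb : ∀ x y z, weight (u x y z) ≤ weight i → (z : ℤ) < y →
        g (u x y z) = sgn y z • rightGen N b (g (u x z y)) := by
      intro x y z hw hlt
      obtain ⟨h1, h2, h3, h4, h5, h6⟩ := hu' x y z
      have := hD _ hw b (by rwa [h3, h4])
      rwa [h3, h4, h6] at this
    have wa : ∀ x y z : Index m n, (y : ℤ) < x → weight (u y x z) < weight (u x y z) := by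
      intro x y z hlt
      obtain ⟨h1, h2, h3, h4, h5, h6⟩ := hu' x y z
      rw [← h5]
      exact weight_tupleAct_lt (by rwa [h1, h2])
    have wb : ∀ x y z : Index m n, (z : ℤ) < y → weight (u x z y) < weight (u x y z) := by
      intro x y z hlt
      obtain ⟨h1, h2, h3, h4, h5, h6⟩ := hu' x y z
      rw [← h6]
      exact weight_tupleAct_lt (by rwa [h3, h4])
    have xa : ∀ x z, weight (u x x z) < weight i →
        rightGen N a (g (u x x z)) = diagScalar x • g (u x x z) := by
      intro x z hw
      obtain ⟨h1, h2, h3, h4, h5, h6⟩ := hu' x x z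
      have := hX _ hw a (by rw [h1, h2])
      rwa [h2] at this
    have xb : ∀ x z, weight (u z x x) < weight i →
        rightGen N b (g (u z x x)) = diagScalar x • g (u z x x) := by
      intro x z hw
      obtain ⟨h1, h2, h3, h4, h5, h6⟩ := hu' z x x
      have := hX _ hw b (by rw [h3, h4])
      rwa [h4] at this
    obtain ⟨h1, h2, h3, h4, h5, h6⟩ := hu' (leftEntry i a) (i a) (i b)
    rw [hu] at h1 h2 h3 h4 h5 h6
    rw [← hu] at ra rb xa xb
    rcases hab with ⟨rfl, rfl⟩ | ⟨rfl, rfl⟩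
    · -- `(x, x, z)` with `z < x`
      rw [h3] at hl
      rw [← hu]
      simp only [hu' _ _ _]
      rw [hk] at *
      generalize i k = x at *
      generalize i l = z at *
      have w1 := wb x x z hl
      have w2 := wa x z x hl
      rw [rb x x z le_rfl hl, ra x z x (by omega) hl]
      simp only [map_smul, rightGen_braidThree ha hb]
      rw [xb x z (by omega)]
      simp only [map_smul]
      module
    · -- `(x, z, z)` with `z < x`
      have hx : i l = i k := h3.symm.trans hk
      rw [← hu]
      simp only [hu' _ _ _]
      generalize leftEntry i l = x at *
      generalize i l = z at *
      generalize i k = y at *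
      subst hx
      have w1 := wa x z z hl
      have w2 := wb z x z hl
      rw [ra x z z le_rfl hl, rb z x z (by omega) hl]
      simp only [map_smul, ← rightGen_braidThree ha hb]
      rw [xa z x (by omega)]
      simp only [map_smul]
      module

open Classical in
/-- The extension of a family of vectors given on the dominant tuples to all tuples: a descent is
removed and compensated by a generator of `ℋ`. -/
noncomputable def extend (G : (Fin d → Index m n) → N) (i : Fin d → Index m n) : N :=
  if h : ∃ k, (i k : ℤ) < leftEntry i k then
    sgn (leftEntry i h.choose) (i h.choose) •
      rightGen N h.choose (extend G (tupleAct i h.choose))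
  else G i
termination_by weight i
decreasing_by exact weight_tupleAct_lt h.choose_spec

theorem extend_of_isDominant (G : (Fin d → Index m n) → N) (hi : IsDominant i) :
    extend G i = G i := by
  rw [extend, dif_neg]
  rintro ⟨k, hk⟩
  have := hi k
  omega

theorem descentRule_extend (G : (Fin d → Index m n) → N) (i : Fin d → Index m n) :
    DescentRule (extend G) i := by
  induction h : weight i using Nat.strong_induction_on generalizing i with
  | _ w ih =>
    subst h
    have hD : ∀ j, weight j < weight i → DescentRule (extend G) j := fun j hj => ih _ hj j rfl
    intro k hk
    have hex : ∃ k, (i k : ℤ) < leftEntry i k := ⟨k, hk⟩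
    rw [extend, dif_pos hex]
    have hl := hex.choose_spec
    generalize hex.choose = l at hl ⊢
    rcases lt_trichotomy (k : ℕ) l with h | h | h
    · exact (descentRule_confluent hD h hk hl).symm
    · rw [Fin.ext h]
    · exact descentRule_confluent hD h hl hk

theorem fixedRule_extend (G : (Fin d → Index m n) → N)
    (hG : ∀ i, IsDominant i → FixedRule G i) (i : Fin d → Index m n) :
    FixedRule (extend G) i := by
  induction h : weight i using Nat.strong_induction_on generalizing i with
  | _ w ih =>
    subst h
    by_cases hi : IsDominant i
    · intro k hk
      rw [extend_of_isDominant G hi]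
      exact hG i hi k hk
    · simp only [IsDominant, not_forall, not_le] at hi
      obtain ⟨l, hl⟩ := hi
      exact fun k hk => fixedRule_of_descent (fun j _ => descentRule_extend G j)
        (fun j hj => ih _ hj j rfl) hk hl

/-- The universal property of `V_{m|n}^{⊗ d}`: a homomorphism of right `ℋ`-modules is given by the
images of the vectors `𝐞_𝐢` for dominant `𝐢`, which may be any vectors on which the reflections
fixing `𝐢` act by the same scalars as on `𝐞_𝐢`. -/
theorem exists_heckeHom (G : (Fin d → Index m n) → N) (hG : ∀ i, IsDominant i → FixedRule G i) :
    ∃ F : TensorSpace m n d →ₗ[(Hecke d)ᵐᵒᵖ] N,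
      ∀ i, IsDominant i → F (boldBasis m n d i) = G i := by
  let f : TensorSpace m n d →ₗ[Laurent] N := (boldBasis m n d).constr Laurent (extend G)
  have hf : ∀ i, f (boldBasis m n d i) = extend G i :=
    fun i => (boldBasis m n d).constr_basis Laurent _ _
  -- the formula for the tuples without a descent at `k`, read backwards
  have hup : ∀ i k, (leftEntry i k : ℤ) < i k →
      rightGen N k (extend G i) = sgn (leftEntry i k) (i k) • extend G (tupleAct i k) := by
    intro i k h
    have := descentRule_extend G (tupleAct i k) k (by
      rwa [leftEntry_tupleAct, tupleAct_apply_self])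
    rw [leftEntry_tupleAct, tupleAct_apply_self, tupleAct_tupleAct] at this
    rw [this, smul_smul, sgn_comm (i k), sgn_sq, one_smul]
  have hcomm : ∀ (k : Fin d) x,
      f (MulOpposite.op (heckeGen k) • x) = MulOpposite.op (heckeGen k) • f x := by
    intro k x
    suffices h : f ∘ₗ genOp m n k = rightGen N k ∘ₗ f by
      rw [op_smul_def, heckeAction_heckeGen, MulOpposite.unop_op]
      exact LinearMap.congr_fun h x
    refine (boldBasis m n d).ext fun i => ?_
    rw [LinearMap.comp_apply, LinearMap.comp_apply, genOp_boldBasis, hf]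
    rcases lt_trichotomy (leftEntry i k : ℤ) (i k) with h | h | h
    · rw [if_pos h, map_smul, hf, hup i k h]
    · rw [if_neg (by omega), if_pos h, map_smul, hf,
        fixedRule_extend G hG i k (Subtype.ext h)]
    · rw [if_neg (by omega), if_neg (by omega), map_add, map_smul, map_smul, hf, hf,
        descentRule_extend G i k h, map_smul, rightGen_rightGen]
      have := sgn_sq (leftEntry i k) (i k)
      module
  refine ⟨heckeHom f hcomm, fun i hi => ?_⟩
  change f _ = _
  rw [hf, extend_of_isDominant G hi]

end Extension

/-! ### The Weyl group as the set of regular tuples -/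

section Regular

variable {d : ℕ}

/-- The number `j + 1` as an element of `[-d..d]`, for a position `j < d`. -/
def posIndex (j : Fin d) : SymInt d :=
  ⟨(j : ℤ) + 1, by have := j.2; simp only [Set.mem_Icc]; omega⟩

/-- The tuple `(w 1, …, w d)` of an element `w` of the Weyl group, with entries among the indices
of the space `V_{d|0}`. -/
def regTuple (w : weylGroup d) : Fin d → Index d 0 := fun j => w.1 (posIndex j)

theorem weylGroup_apply_neg (w : weylGroup d) (i : SymInt d) :
    w.1 (SymInt.neg i) = SymInt.neg (w.1 i) := w.2 i

theorem simple_apply_zero {k : Fin d} (hk : (k : ℕ) = 0) (i : SymInt d) :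
    (((simple k).1 i : SymInt d) : ℤ)
      = if (i : ℤ) = -1 then 1 else if (i : ℤ) = 1 then -1 else (i : ℤ) := by
  change ((simplePerm k i : SymInt d) : ℤ) = _
  rw [simplePerm, if_pos hk, coe_transposition]

theorem simple_apply_pos {k : Fin d} (hk : (k : ℕ) ≠ 0) (i : SymInt d) :
    (((simple k).1 i : SymInt d) : ℤ)
      = if (i : ℤ) = k then (k : ℤ) + 1 else if (i : ℤ) = k + 1 then (k : ℤ)
        else if (i : ℤ) = -k then -(k : ℤ) - 1 else if (i : ℤ) = -(k : ℤ) - 1 then -(k : ℤ)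
        else (i : ℤ) := by
  change ((simplePerm k i : SymInt d) : ℤ) = _
  rw [simplePerm, if_neg hk, Equiv.Perm.mul_apply, coe_transposition, coe_transposition]
  split_ifs <;> omega

theorem simple_mul_simple (k : Fin d) : simple k * simple k = 1 := by
  apply Subtype.ext
  refine Equiv.ext fun i => Subtype.ext ?_
  change (((simple k).1 ((simple k).1 i) : SymInt d) : ℤ) = i
  by_cases hk : (k : ℕ) = 0
  · rw [simple_apply_zero hk, simple_apply_zero hk]
    grind
  · rw [simple_apply_pos hk, simple_apply_pos hk]
    grind

theorem mul_simple_mul_simple (w : weylGroup d) (k : Fin d) : w * simple k * simple k = w := by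
  rw [mul_assoc, simple_mul_simple, mul_one]

theorem simple_inv (k : Fin d) : (simple k)⁻¹ = simple k :=
  inv_eq_of_mul_eq_one_left (simple_mul_simple k)

theorem leftEntry_regTuple (w : weylGroup d) (k : Fin d) :
    leftEntry (regTuple w) k = w.1 ((simple k).1 (posIndex k)) := by
  by_cases hk : (k : ℕ) = 0
  · rw [leftEntry_zero hk]
    refine (weylGroup_apply_neg w _).symm.trans (congrArg w.1 (Subtype.ext ?_))
    rw [simple_apply_zero hk]
    simp only [SymInt.coe_neg, posIndex]
    split_ifs <;> omega
  · rw [leftEntry_pos hk]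
    refine congrArg w.1 (Subtype.ext ?_)
    rw [simple_apply_pos hk]
    simp only [posIndex, prev]
    split_ifs <;> omega

theorem tupleAct_regTuple (w : weylGroup d) (k : Fin d) :
    tupleAct (regTuple w) k = regTuple (w * simple k) := by
  funext j
  by_cases hjk : j = k
  · subst hjk
    rw [tupleAct_apply_self, leftEntry_regTuple]
    rfl
  · have hjk' : (j : ℕ) ≠ k := fun h => hjk (Fin.ext h)
    change _ = w.1 ((simple k).1 (posIndex j))
    by_cases hk : (k : ℕ) = 0
    · rw [tupleAct_zero hk, Function.update_of_ne hjk]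
      refine congrArg w.1 (Subtype.ext ?_)
      rw [simple_apply_zero hk]
      simp only [posIndex]
      split_ifs <;> omega
    · rw [tupleAct_pos hk, Function.comp_apply]
      refine congrArg w.1 (Subtype.ext ?_)
      rw [simple_apply_pos hk, Equiv.swap_apply_def, if_neg hjk]
      split_ifs with h1 h2 h3 h4 h5 <;> simp only [posIndex, prev, Fin.ext_iff] at * <;> omega

/-- An element of the Weyl group is determined by its values at `1, …, d`. -/
theorem regTuple_injective : Function.Injective (regTuple (d := d)) := by
  intro w w' h
  have hpos : ∀ i : SymInt d, 0 < (i : ℤ) → w.1 i = w'.1 i := by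
    intro i hi
    have hb := i.2
    simp only [Set.mem_Icc] at hb
    have := congrFun h ⟨((i : ℤ) - 1).toNat, by omega⟩
    have hi' : posIndex (d := d) ⟨((i : ℤ) - 1).toNat, by omega⟩ = i := by
      apply Subtype.ext; simp only [posIndex]; omega
    change w.1 (posIndex _) = w'.1 (posIndex _) at this
    rwa [hi'] at this
  apply Subtype.ext
  refine Equiv.ext fun i => ?_
  rcases lt_trichotomy (i : ℤ) 0 with hi | hi | hi
  · have := hpos (SymInt.neg i) (by rw [SymInt.coe_neg]; omega)
    rw [weylGroup_apply_neg, weylGroup_apply_neg] at this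
    rw [← SymInt.neg_neg (w.1 i), this, SymInt.neg_neg]
  · have h0 : SymInt.neg i = i := Subtype.ext (by rw [SymInt.coe_neg]; omega)
    have h1 := congrArg Subtype.val (weylGroup_apply_neg w i)
    have h2 := congrArg Subtype.val (weylGroup_apply_neg w' i)
    rw [h0] at h1 h2
    rw [SymInt.coe_neg] at h1 h2
    exact Subtype.ext (by omega)
  · exact hpos i hi

theorem leftEntry_regTuple_ne (w : weylGroup d) (k : Fin d) :
    (leftEntry (regTuple w) k : ℤ) ≠ regTuple w k := by
  intro h
  rw [leftEntry_regTuple] at h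
  have h' := congrArg Subtype.val (w.1.injective (Subtype.ext h))
  by_cases hk : (k : ℕ) = 0
  · rw [simple_apply_zero hk] at h'
    simp only [posIndex] at h'
    split_ifs at h' <;> omega
  · rw [simple_apply_pos hk] at h'
    simp only [posIndex] at h'
    split_ifs at h' <;> omega

theorem eq_one_of_isDominant {w : weylGroup d} (h : IsDominant (regTuple w)) : w = 1 := by
  apply regTuple_injective
  have hlt : ∀ k, (leftEntry (regTuple w) k : ℤ) < regTuple w k :=
    fun k => lt_of_le_of_ne (h k) (leftEntry_regTuple_ne w k)
  -- the entries are positive and strictly increasing, hence `i_{j+1} ≥ j + 1`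
  have hlow : ∀ j (hj : j < d), (j : ℤ) + 1 ≤ regTuple w ⟨j, hj⟩ := by
    intro j
    induction j with
    | zero =>
      intro hj
      have := hlt ⟨0, hj⟩
      rw [leftEntry_zero rfl, SymInt.coe_neg] at this
      push_cast
      omega
    | succ j ih =>
      intro hj
      have h1 := hlt ⟨j + 1, hj⟩
      rw [leftEntry_pos (Nat.succ_ne_zero j)] at h1
      have h2 := ih (by omega)
      have h3 : prev (⟨j + 1, hj⟩ : Fin d) = ⟨j, by omega⟩ := Fin.ext (by simp [prev])
      rw [h3] at h1
      push_cast
      omega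
  -- downwards from `i_d ≤ d`, hence `i_{j+1} ≤ j + 1`
  have hup : ∀ r j (hj : j < d), d = j + 1 + r → (regTuple w ⟨j, hj⟩ : ℤ) ≤ (j : ℤ) + 1 := by
    intro r
    induction r with
    | zero =>
      intro j hj hd
      have := (regTuple w ⟨j, hj⟩).2
      simp only [Set.mem_Icc] at this
      push_cast at this
      omega
    | succ r ih =>
      intro j hj hd
      have h1 := hlt ⟨j + 1, by omega⟩
      rw [leftEntry_pos (Nat.succ_ne_zero j)] at h1
      have h2 := ih (j + 1) (by omega) (by omega)
      have h3 : prev (⟨j + 1, by omega⟩ : Fin d) = ⟨j, by omega⟩ := Fin.ext (by simp [prev])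
      rw [h3] at h1
      push_cast at h2
      omega
  funext j
  refine Subtype.ext ?_
  have h1 := hlow j j.2
  have h2 := hup (d - (j + 1)) j j.2 (by omega)
  change (regTuple w j : ℤ) = (j : ℤ) + 1
  exact le_antisymm h2 h1

theorem isDominant_regTuple_one : IsDominant (regTuple (1 : weylGroup d)) := by
  intro k
  rw [leftEntry_regTuple]
  change (((simple k).1 (posIndex k) : SymInt d) : ℤ) ≤ (posIndex k : SymInt d)
  by_cases hk : (k : ℕ) = 0
  · rw [simple_apply_zero hk]
    simp only [posIndex]
    split_ifs <;> omega
  · rw [simple_apply_pos hk]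
    simp only [posIndex]
    split_ifs <;> omega

/-- Right multiplication by `s_k` raises the length of `w`, expressed by the values of `w`. -/
def IsAscent (w : weylGroup d) (k : Fin d) : Prop := (leftEntry (regTuple w) k : ℤ) < regTuple w k

theorem isAscent_mul_simple {w : weylGroup d} {k : Fin d} :
    IsAscent (w * simple k) k ↔ ¬ IsAscent w k := by
  have := leftEntry_regTuple_ne w k
  unfold IsAscent
  rw [← tupleAct_regTuple, leftEntry_tupleAct, tupleAct_apply_self]
  omega

/-- Induction over the Weyl group along ascents. -/
theorem weyl_induction {p : weylGroup d → Prop} (one : p 1)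
    (step : ∀ w k, IsAscent w k → p w → p (w * simple k)) (w) : p w := by
  suffices h : ∀ i, ∀ w : weylGroup d, regTuple w = i → p w from h _ w rfl
  intro i
  induction i using tuple_induction with
  | dominant i hi =>
    rintro w rfl
    rwa [eq_one_of_isDominant hi]
  | step i k hk ih =>
    rintro w rfl
    have h := ih (w * simple k) (tupleAct_regTuple w k).symm
    have h' : IsAscent (w * simple k) k := isAscent_mul_simple.mpr (by unfold IsAscent; omega)
    have := step _ k h' h
    rwa [mul_simple_mul_simple] at this

theorem hat_of_no_odd {m : ℕ} (i : Index m 0) : hat i = 0 := by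
  have := i.2
  simp only [Set.mem_Icc] at this
  exact if_pos (abs_le.mpr this)

theorem sgn_of_no_odd {m : ℕ} (x y : Index m 0) : sgn x y = 1 := by
  simp [sgn, hat_of_no_odd]

theorem diagScalar_of_no_odd {m : ℕ} (x : Index m 0) : diagScalar x = q := by
  simp [diagScalar, hat_of_no_odd]

theorem op_heckeGen_smul_regTuple {w : weylGroup d} {k : Fin d} (h : IsAscent w k) :
    MulOpposite.op (heckeGen k) • boldBasis d 0 d (regTuple w) =
      boldBasis d 0 d (regTuple (w * simple k)) := by
  rw [heckeGen_smul_of_lt h, sgn_of_no_odd, one_smul, tupleAct_regTuple]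

/-- The vector `𝐞_{(1, …, d)}` of `V_{d|0}^{⊗ d}` generates a free `ℋ`-module: `ℋ` acts faithfully
on it. -/
theorem op_smul_regTuple_one_injective :
    Function.Injective fun h : Hecke d =>
      MulOpposite.op h • boldBasis d 0 d (regTuple (1 : weylGroup d)) := by
  classical
  obtain ⟨F, hF⟩ := exists_heckeHom (N := Hecke d) (m := d) (n := 0)
    (fun i => if i = regTuple (1 : weylGroup d) then 1 else 0) (by
      intro i _ k hk
      by_cases hi : i = regTuple 1
      · subst hi
        exact absurd (congrArg Subtype.val hk) (leftEntry_regTuple_ne _ k)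
      · simp [hi])
  intro h h' e
  have := congrArg F e
  simp only [map_smul, hF _ isDominant_regTuple_one, if_true, MulOpposite.smul_eq_mul_unop,
    MulOpposite.unop_op, one_mul] at this
  exact this

theorem coe_qUnit : ((qUnit : Laurentˣ) : Laurent) = q := rfl

theorem q_eq : q = LaurentPolynomial.T 2 := by
  change LaurentPolynomial.T 1 ^ 2 = _
  rw [LaurentPolynomial.T_pow]
  norm_num

theorem q_pow_injective : Function.Injective fun a : ℕ => q ^ a := by
  intro a b h
  simp only [q_eq, LaurentPolynomial.T_pow] at h
  have := Finsupp.single_left_injective (one_ne_zero (α := ℤ)) (AddMonoidAlgebra.coeff_inj.mpr h)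
  omega

/-- The homomorphism from the regular module to the module `V_{0|0}^{⊗ d}`, on which every
generator acts by `q`, maps `𝐞_w` to the power of `q` whose exponent counts the ascents on a path
from `1` to `w`. -/
theorem exists_ascent_length :
    ∃ L : weylGroup d → ℕ, L 1 = 0 ∧ ∀ w k, IsAscent w k → L (w * simple k) = L w + 1 := by
  let b := boldBasis 0 0 d (fun _ => ⟨0, by simp⟩)
  have hb : ∀ k : Fin d, MulOpposite.op (heckeGen k) • b = q • b := by
    intro k
    have hsub : ∀ x y : Index 0 0, x = y := by
      intro x y
      have hx := x.2
      have hy := y.2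
      simp only [Set.mem_Icc] at hx hy
      push_cast at hx hy
      exact Subtype.ext (by omega)
    rw [heckeGen_smul_of_eq (hsub _ _), diagScalar_of_no_odd]
  obtain ⟨F, hF⟩ := exists_heckeHom (N := TensorSpace 0 0 d) (d := d) (m := d) (n := 0) (fun _ => b)
    (by
      intro i _ k _
      rw [rightGen_apply, hb, diagScalar_of_no_odd])
  have hstep : ∀ w k a, IsAscent w k → F (boldBasis d 0 d (regTuple w)) = q ^ a • b →
      F (boldBasis d 0 d (regTuple (w * simple k))) = q ^ (a + 1) • b := by
    intro w k a h ha
    rw [← op_heckeGen_smul_regTuple h, map_smul, ha, smul_comm, hb, smul_smul, pow_succ]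
  have hex : ∀ w : weylGroup d, ∃ a, F (boldBasis d 0 d (regTuple w)) = q ^ a • b := by
    intro w
    induction w using weyl_induction with
    | one => exact ⟨0, by rw [hF _ isDominant_regTuple_one, pow_zero, one_smul]⟩
    | step w k h ih =>
      obtain ⟨a, ha⟩ := ih
      exact ⟨a + 1, hstep w k a h ha⟩
  have hinj : ∀ a a' : ℕ, q ^ a • b = q ^ a' • b → a = a' := by
    intro a a' h
    have := congrArg (fun x => (boldBasis 0 0 d).repr x (fun _ => ⟨0, by simp⟩)) h
    simp only [b, map_smul, Module.Basis.repr_self, Finsupp.smul_apply, Finsupp.single_eq_same,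
      smul_eq_mul, mul_one] at this
    exact q_pow_injective this
  choose L hL using hex
  refine ⟨L, hinj _ _ ?_, fun w k h => hinj _ _ ?_⟩
  · rw [← hL, hF _ isDominant_regTuple_one, pow_zero, one_smul]
  · rw [← hL, hstep w k _ h (hL w)]

/-- The length function of the Weyl group and the elements `T_w`, characterized by ascents. -/
theorem len_and_heckeT :
    (∀ (w : weylGroup d) k, IsAscent w k → len (w * simple k) = len w + 1) ∧
    ∀ w : weylGroup d, MulOpposite.op (heckeT w) • boldBasis d 0 d (regTuple (1 : weylGroup d)) =
      boldBasis d 0 d (regTuple w) := by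
  obtain ⟨L, hL1, hL⟩ := exists_ascent_length (d := d)
  have hdesc : ∀ (w : weylGroup d) k, ¬ IsAscent w k → L w = L (w * simple k) + 1 := by
    intro w k h
    rw [← hL _ k (isAscent_mul_simple.mpr h), mul_simple_mul_simple]
  have hle : ∀ l : List (Fin d), L (l.map simple).prod ≤ l.length := by
    intro l
    induction l using List.reverseRecOn with
    | nil => simp [hL1]
    | append_singleton l k ih =>
      simp only [List.map_append, List.map_cons, List.map_nil, List.prod_append, List.prod_cons,
        List.prod_nil, mul_one, List.length_append, List.length_cons, List.length_nil]
      by_cases h : IsAscent (l.map simple).prod k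
      · rw [hL _ k h]; omega
      · have := hdesc _ k h; omega
  have hex : ∀ w : weylGroup d, ∃ l : List (Fin d), (l.map simple).prod = w ∧ l.length = L w := by
    intro w
    induction w using weyl_induction with
    | one => exact ⟨[], by simp [hL1]⟩
    | step w k h ih =>
      obtain ⟨l, rfl, hl⟩ := ih
      exact ⟨l ++ [k], by simp, by simp [hL _ k h, hl]⟩
  have hlen : ∀ w : weylGroup d, len w = L w := by
    intro w
    obtain ⟨l, hl, hl'⟩ := hex w
    refine le_antisymm (Nat.sInf_le ⟨l, hl', hl⟩) ?_
    refine le_csInf ⟨_, l, hl', hl⟩ ?_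
    rintro r ⟨l', rfl, rfl⟩
    exact hle l'
  refine ⟨fun w k h => by rw [hlen, hlen, hL w k h], fun w => ?_⟩
  -- every step of a reduced word is an ascent
  have hred : ∀ l : List (Fin d), l.length = L (l.map simple).prod →
      MulOpposite.op (l.map heckeGen).prod • boldBasis d 0 d (regTuple (1 : weylGroup d)) =
        boldBasis d 0 d (regTuple (l.map simple).prod) := by
    intro l
    induction l using List.reverseRecOn with
    | nil => intro _; simp
    | append_singleton l k ih =>
      simp only [List.map_append, List.map_cons, List.map_nil, List.prod_append, List.prod_cons,
        List.prod_nil, mul_one, List.length_append, List.length_cons, List.length_nil]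
      intro h
      have h1 := hle l
      have hasc : IsAscent (l.map simple).prod k := by
        by_contra hna
        have := hdesc _ k hna
        omega
      have h2 := hL _ k hasc
      rw [MulOpposite.op_mul, mul_smul, ih (by omega), op_heckeGen_smul_regTuple hasc]
  obtain ⟨h1, h2⟩ : IsReducedWord w (reducedWord w) := by
    obtain ⟨l, hl, hl'⟩ := hex w
    exact Classical.epsilon_spec (p := IsReducedWord w) ⟨l, hl, by rw [hl', hlen]⟩
  have := hred (reducedWord w) (by rw [h1, h2, hlen])
  rwa [h1] at this

theorem len_mul_simple {w : weylGroup d} {k : Fin d} (h : IsAscent w k) :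
    len (w * simple k) = len w + 1 := len_and_heckeT.1 w k h

theorem heckeT_one : heckeT (1 : weylGroup d) = 1 := by
  apply op_smul_regTuple_one_injective
  simp only [len_and_heckeT.2, MulOpposite.op_one, one_smul]

/-- `T_w T_{s_k} = T_{w s_k}` if `s_k` raises the length of `w`. -/
theorem heckeT_mul_of_isAscent {w : weylGroup d} {k : Fin d} (h : IsAscent w k) :
    heckeT w * heckeGen k = heckeT (w * simple k) := by
  apply op_smul_regTuple_one_injective
  simp only [MulOpposite.op_mul, mul_smul, len_and_heckeT.2, op_heckeGen_smul_regTuple h]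

/-- `T_w T_{s_k} = (q - 1) T_w + q T_{w s_k}` if `s_k` lowers the length of `w`. -/
theorem heckeT_mul_of_not_isAscent {w : weylGroup d} {k : Fin d} (h : ¬ IsAscent w k) :
    heckeT w * heckeGen k = (q - 1) • heckeT w + q • heckeT (w * simple k) := by
  have := heckeT_mul_of_isAscent (isAscent_mul_simple.mpr h)
  rw [mul_simple_mul_simple] at this
  rw [← this, mul_assoc, heckeGen_mul_self, mul_add, mul_smul_comm, mul_smul_comm, mul_one]

end Regular

/-! ### Sums over parabolic subgroups -/

section Parabolic

variable {d : ℕ}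

open Classical in
/-- The sum of the `T_w` over a subgroup `K` is an eigenvector for the `T_{s_k}` with `s_k ∈ K`: the
terms of `w` and `w s_k` cancel in pairs. -/
theorem sum_heckeT_mul_heckeGen (K : Subgroup (weylGroup d)) {k : Fin d} (hk : simple k ∈ K) :
    (∑ w : weylGroup d with w ∈ K, heckeT w) * heckeGen k =
      q • ∑ w : weylGroup d with w ∈ K, heckeT w := by
  have hpair : ∀ w : weylGroup d, IsAscent w k →
      (heckeT w * heckeGen k - q • heckeT w) +
        (heckeT (w * simple k) * heckeGen k - q • heckeT (w * simple k)) = 0 := by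
    intro w h
    rw [heckeT_mul_of_isAscent h, heckeT_mul_of_not_isAscent (w := w * simple k)
      (by rw [isAscent_mul_simple]; exact not_not.mpr h), mul_simple_mul_simple]
    module
  rw [← sub_eq_zero, Finset.sum_mul, Finset.smul_sum, ← Finset.sum_sub_distrib]
  refine Finset.sum_involution (fun w _ => w * simple k) ?_ ?_ ?_ ?_
  · intro w _
    by_cases h : IsAscent w k
    · exact hpair w h
    · have := hpair _ (isAscent_mul_simple.mpr h)
      rwa [mul_simple_mul_simple, add_comm] at this
  · intro w _ _ h
    have := @isAscent_mul_simple d w k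
    rw [h] at this
    tauto
  · intro w hw
    simp only [Finset.mem_filter, Finset.mem_univ, true_and] at hw ⊢
    exact K.mul_mem hw hk
  · intro w _
    exact mul_simple_mul_simple w k

open Classical in
/-- The signed sum of the `T_w` over a subgroup `K` is an eigenvector for the `T_{s_k}` with
`s_k ∈ K`. -/
theorem sum_smul_heckeT_mul_heckeGen (K : Subgroup (weylGroup d)) {k : Fin d}
    (hk : simple k ∈ K) :
    (∑ w : weylGroup d with w ∈ K,
        (((-qUnit) ^ (-(len w : ℤ)) : Laurentˣ) : Laurent) • heckeT w) * heckeGen k =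
      -∑ w : weylGroup d with w ∈ K,
        (((-qUnit) ^ (-(len w : ℤ)) : Laurentˣ) : Laurent) • heckeT w := by
  set a : weylGroup d → Laurent := fun w => (((-qUnit) ^ (-(len w : ℤ)) : Laurentˣ) : Laurent)
    with ha
  have hstep : ∀ w : weylGroup d, IsAscent w k → a w = -q * a (w * simple k) := by
    intro w h
    have : (-qUnit) ^ (-(len w : ℤ)) = -qUnit * (-qUnit) ^ (-(len (w * simple k) : ℤ)) := by
      rw [len_mul_simple h, ← zpow_one_add]
      congr 1
      push_cast
      ring
    simp only [ha, this]
    rw [Units.val_mul, Units.val_neg, coe_qUnit]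
  have hpair : ∀ w : weylGroup d, IsAscent w k →
      (a w • heckeT w * heckeGen k + a w • heckeT w) +
        (a (w * simple k) • heckeT (w * simple k) * heckeGen k +
          a (w * simple k) • heckeT (w * simple k)) = 0 := by
    intro w h
    rw [smul_mul_assoc, smul_mul_assoc, heckeT_mul_of_isAscent h,
      heckeT_mul_of_not_isAscent (w := w * simple k)
      (by rw [isAscent_mul_simple]; exact not_not.mpr h), mul_simple_mul_simple, hstep w h]
    module
  rw [← sub_eq_zero, sub_neg_eq_add, Finset.sum_mul, ← Finset.sum_add_distrib]
  refine Finset.sum_involution (fun w _ => w * simple k) ?_ ?_ ?_ ?_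
  · intro w _
    by_cases h : IsAscent w k
    · exact hpair w h
    · have := hpair _ (isAscent_mul_simple.mpr h)
      rwa [mul_simple_mul_simple, add_comm] at this
  · intro w _ _ h
    have := @isAscent_mul_simple d w k
    rw [h] at this
    tauto
  · intro w hw
    simp only [Finset.mem_filter, Finset.mem_univ, true_and] at hw ⊢
    exact K.mul_mem hw hk
  · intro w _
    exact mul_simple_mul_simple w k

/-- Induction over a subgroup generated by simple reflections. -/
theorem parabolic_induction {J : Fin d → Prop} {S : Set (weylGroup d)}
    (hS : ∀ s ∈ S, ∃ k, J k ∧ simple k = s) {p : weylGroup d → Prop} (one : p 1)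
    (step : ∀ w k, J k → p w → p (w * simple k)) {w : weylGroup d}
    (hw : w ∈ Subgroup.closure S) : p w := by
  induction hw using Subgroup.closure_induction_right with
  | one => exact one
  | mul_right x hx y hy ih =>
    obtain ⟨k, hk, rfl⟩ := hS y hy
    exact step x k hk ih
  | mul_inv_cancel x hx y hy ih =>
    obtain ⟨k, hk, rfl⟩ := hS y hy
    rw [simple_inv]
    exact step x k hk ih

/-- `T_w` commutes with everything that commutes with the generators of a parabolic subgroup
containing `w`. -/
theorem commute_heckeT {J : Fin d → Prop} {S : Set (weylGroup d)}
    (hS : ∀ s ∈ S, ∃ k, J k ∧ simple k = s) {x : Hecke d} (hx : ∀ k, J k → Commute x (heckeGen k))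
    {w : weylGroup d} (hw : w ∈ Subgroup.closure S) : Commute x (heckeT w) := by
  refine parabolic_induction hS (p := fun w => Commute x (heckeT w)) ?_ ?_ hw
  · rw [heckeT_one]; exact Commute.one_right x
  · intro w k hk ih
    by_cases h : IsAscent w k
    · rw [← heckeT_mul_of_isAscent h]
      exact ih.mul_right (hx k hk)
    · -- here `T_w = T_{w s_k} T_{s_k}`, and `T_{s_k}` can be cancelled
      have e := heckeT_mul_of_isAscent (isAscent_mul_simple.mpr h)
      rw [mul_simple_mul_simple] at e
      rw [← e] at ih
      refine (isUnit_heckeGen k).mul_left_injective ?_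
      change x * heckeT (w * simple k) * heckeGen k = heckeT (w * simple k) * x * heckeGen k
      rw [mul_assoc, ih.eq, mul_assoc, ← (hx k hk).eq, ← mul_assoc]

/-- A common eigenvector of the generators of a parabolic subgroup is an eigenvector of its
`T_w`. -/
theorem op_heckeT_smul {N : Type*} [AddCommGroup N] [Module Laurent N] [Module (Hecke d)ᵐᵒᵖ N]
    [IsScalarTower Laurent (Hecke d)ᵐᵒᵖ N] {J : Fin d → Prop} {S : Set (weylGroup d)}
    (hS : ∀ s ∈ S, ∃ k, J k ∧ simple k = s) {x : N} {t : Laurent}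
    (hx : ∀ k, J k → MulOpposite.op (heckeGen k) • x = t • x)
    {w : weylGroup d} (hw : w ∈ Subgroup.closure S) :
    MulOpposite.op (heckeT w) • x = t ^ len w • x := by
  have hlen1 : len (1 : weylGroup d) = 0 := Nat.sInf_eq_zero.mpr (Or.inl ⟨[], rfl, rfl⟩)
  refine parabolic_induction hS
    (p := fun w => MulOpposite.op (heckeT w) • x = t ^ len w • x) ?_ ?_ hw
  · rw [heckeT_one, hlen1, MulOpposite.op_one, one_smul, pow_zero, one_smul]
  · intro w k hk ih
    by_cases h : IsAscent w k
    · rw [← heckeT_mul_of_isAscent h, MulOpposite.op_mul, mul_smul, ih, smul_comm, hx k hk,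
        len_mul_simple h, smul_smul, pow_succ]
    · -- here `T_w = T_{w s_k} T_{s_k}`, and `T_{s_k}` can be cancelled
      have e := heckeT_mul_of_isAscent (isAscent_mul_simple.mpr h)
      have e' := len_mul_simple (isAscent_mul_simple.mpr h)
      rw [mul_simple_mul_simple] at e e'
      have hu : IsUnit (MulOpposite.op (heckeGen k)) := (isUnit_heckeGen k).op
      refine hu.smul_left_cancel.mp ?_
      rw [smul_smul, ← MulOpposite.op_mul, e, ih, e', smul_comm, hx k hk, smul_smul, pow_succ]

end Parabolic

/-! ### The elements `[xy]_λ` -/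

section XY

variable {m n d : ℕ} (c : Composition m n d)

theorem exists_of_even_generator :
    ∀ s ∈ {w : weylGroup d | ∃ k : Fin d, IsParabolicIndex c k ∧ (k : ℕ) < partialSum c m ∧
      simple k = w}, ∃ k, (IsParabolicIndex c k ∧ (k : ℕ) < partialSum c m) ∧ simple k = s :=
  fun _ ⟨k, h1, h2, h3⟩ => ⟨k, ⟨h1, h2⟩, h3⟩

theorem exists_of_odd_generator :
    ∀ s ∈ {w : weylGroup d | ∃ k : Fin d, IsParabolicIndex c k ∧ partialSum c m < (k : ℕ) ∧
      simple k = w}, ∃ k, (IsParabolicIndex c k ∧ partialSum c m < (k : ℕ)) ∧ simple k = s :=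
  fun _ ⟨k, h1, h2, h3⟩ => ⟨k, ⟨h1, h2⟩, h3⟩

open Classical in
theorem xyElt_mul_heckeGen_even {k : Fin d} (hk : IsParabolicIndex c k)
    (hlt : (k : ℕ) < partialSum c m) : xyElt c * heckeGen k = q • xyElt c := by
  have hcomm : Commute (heckeGen k) (yElt c) := by
    refine Commute.sum_right _ _ _ fun w hw => Commute.smul_right ?_ _
    refine commute_heckeT (exists_of_odd_generator c) ?_ (Finset.mem_filter.mp hw).2
    rintro l ⟨_, hl⟩
    exact heckeGen_far (by omega)
  rw [xyElt, mul_assoc, ← hcomm.eq, ← mul_assoc]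
  unfold xElt
  rw [sum_heckeT_mul_heckeGen (evenParabolic c) (Subgroup.subset_closure ⟨k, hk, hlt, rfl⟩),
    smul_mul_assoc]

theorem xyElt_mul_heckeGen_odd {k : Fin d} (hk : IsParabolicIndex c k)
    (hlt : partialSum c m < (k : ℕ)) : xyElt c * heckeGen k = -xyElt c := by
  rw [xyElt, mul_assoc]
  unfold yElt
  rw [sum_smul_heckeT_mul_heckeGen (oddParabolic c) (Subgroup.subset_closure ⟨k, hk, hlt, rfl⟩),
    mul_neg]

/-- On a vector with the eigenvalues `q` and `-1` for the even and the odd generators, `[xy]_λ` acts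
by a nonzero scalar: the specialization of the scalar at `v = 1` is the order of the parabolic
subgroup. -/
theorem exists_op_xyElt_smul {N : Type*} [AddCommGroup N] [Module Laurent N]
    [Module (Hecke d)ᵐᵒᵖ N] [IsScalarTower Laurent (Hecke d)ᵐᵒᵖ N] (x : N)
    (heven : ∀ k : Fin d, IsParabolicIndex c k → (k : ℕ) < partialSum c m →
      MulOpposite.op (heckeGen k) • x = q • x)
    (hodd : ∀ k : Fin d, IsParabolicIndex c k → partialSum c m < (k : ℕ) →
      MulOpposite.op (heckeGen k) • x = (-1 : Laurent) • x) :
    ∃ a : Laurent, a ≠ 0 ∧ MulOpposite.op (xyElt c) • x = a • x := by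
  classical
  let ev : Laurent →+* ℤ := LaurentPolynomial.eval₂ (RingHom.id ℤ) 1
  have hevq : ev q = 1 := by rw [q_eq]; simp [ev]
  have hpos : ∀ K : Subgroup (weylGroup d),
      ∑ w : weylGroup d with w ∈ K, (1 : ℤ) ≠ 0 := by
    intro K
    rw [Finset.sum_const, nsmul_one]
    exact_mod_cast Finset.card_ne_zero_of_mem (a := 1) (by simp [K.one_mem])
  have hx : MulOpposite.op (xElt c) • x =
      (∑ w : weylGroup d with w ∈ evenParabolic c, q ^ len w) • x := by
    unfold xElt
    rw [Finset.op_sum, Finset.sum_smul, Finset.sum_smul]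
    refine Finset.sum_congr (Finset.filter_congr_decidable _ _ _) fun w hw => ?_
    exact op_heckeT_smul (exists_of_even_generator c) (fun k hk => heven k hk.1 hk.2)
      (Finset.mem_filter.mp hw).2
  have hy : MulOpposite.op (yElt c) • x =
      (∑ w : weylGroup d with w ∈ oddParabolic c,
        (((-qUnit) ^ (-(len w : ℤ)) : Laurentˣ) : Laurent) * (-1) ^ len w) • x := by
    unfold yElt
    rw [Finset.op_sum, Finset.sum_smul, Finset.sum_smul]
    refine Finset.sum_congr (Finset.filter_congr_decidable _ _ _) fun w hw => ?_
    rw [MulOpposite.op_smul, smul_assoc,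
      op_heckeT_smul (exists_of_odd_generator c) (fun k hk => hodd k hk.1 hk.2)
      (Finset.mem_filter.mp hw).2, smul_smul]
  refine ⟨_, ?_, by rw [xyElt, MulOpposite.op_mul, mul_smul, hx, smul_comm, hy, smul_smul]⟩
  refine fun h => mul_ne_zero (hpos (evenParabolic c)) (hpos (oddParabolic c)) ?_
  have h' := congrArg ev h
  rw [map_mul, map_zero, map_sum, map_sum] at h'
  rw [← h']
  congr 1
  · refine Finset.sum_congr rfl fun w _ => ?_
    rw [map_pow, hevq, one_pow]
  · refine Finset.sum_congr rfl fun w _ => ?_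
    have hu : Units.map (ev : Laurent →* ℤ) (-qUnit) = -1 := by
      apply Units.ext
      simp [coe_qUnit, hevq]
    have h2 : ev (((-qUnit) ^ (-(len w : ℤ)) : Laurentˣ) : Laurent) =
        ((Units.map (ev : Laurent →* ℤ) ((-qUnit) ^ (-(len w : ℤ))) : ℤˣ) : ℤ) := rfl
    rw [map_mul, h2, map_zpow, hu, map_pow, map_neg, map_one, zpow_neg, zpow_natCast,
      ← inv_pow, inv_neg, inv_one, Units.val_pow_eq_pow_val, Units.val_neg, Units.val_one,
      ← mul_pow]
    simp

end XY

/-! ### Dominant tuples and compositions -/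

section Dominant

variable {m n d : ℕ}

/-- The composition of a tuple, which counts the entries with a given absolute value. -/
def composition (i : Fin d → Index m n) : Composition m n d :=
  ⟨fun a => (Finset.univ.filter fun j : Fin d => (i j : ℤ).natAbs = a).card, by
    have h := Finset.card_eq_sum_card_fiberwise (s := (Finset.univ : Finset (Fin d)))
      (t := (Finset.univ : Finset (Fin (m + n + 1))))
      (f := fun j => ⟨(i j : ℤ).natAbs, by
        have := (i j).2; simp only [Set.mem_Icc] at this; omega⟩)
      (fun _ _ => Finset.mem_univ _)
    rw [Finset.card_univ, Fintype.card_fin] at h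
    refine Eq.trans ?_ h.symm
    refine Finset.sum_congr rfl fun a _ => congrArg Finset.card ?_
    refine Finset.filter_congr fun j _ => ?_
    rw [Fin.ext_iff]⟩

theorem partialSum_composition (i : Fin d → Index m n) (a : ℕ) :
    partialSum (composition i) a =
      (Finset.univ.filter fun j : Fin d => (i j : ℤ).natAbs ≤ a).card := by
  let f : Fin d → Fin (m + n + 1) := fun j => ⟨(i j : ℤ).natAbs, by
    have := (i j).2; simp only [Set.mem_Icc] at this; omega⟩
  have h := Finset.card_eq_sum_card_fiberwise (f := f)
    (s := Finset.univ.filter fun j : Fin d => (i j : ℤ).natAbs ≤ a)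
    (t := Finset.univ.filter fun b : Fin (m + n + 1) => (b : ℕ) ≤ a)
    (fun j hj => by simpa [f] using hj)
  rw [h]
  refine Finset.sum_congr rfl fun b hb => ?_
  change (Finset.univ.filter fun j : Fin d => (i j : ℤ).natAbs = b).card = _
  rw [Finset.filter_filter]
  refine congrArg Finset.card ?_
  refine Finset.filter_congr fun j _ => ?_
  simp only [Finset.mem_filter, Finset.mem_univ, true_and] at hb
  rw [Fin.ext_iff]
  exact ⟨fun h => ⟨by omega, h⟩, fun h => h.2⟩

theorem partialSum_mono (c : Composition m n d) : Monotone (partialSum c) := by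
  intro a b hab
  refine Finset.sum_le_sum_of_subset fun j hj => ?_
  simp only [Finset.mem_filter, Finset.mem_univ, true_and] at hj ⊢
  omega

theorem partialSum_top (c : Composition m n d) {a : ℕ} (ha : m + n ≤ a) : partialSum c a = d := by
  rw [partialSum, Finset.filter_true_of_mem (fun j _ => by omega)]
  exact c.2

theorem partialSum_le (c : Composition m n d) (a : ℕ) : partialSum c a ≤ d := by
  rcases le_total a (m + n) with h | h
  · exact (partialSum_mono c h).trans (partialSum_top c le_rfl).le
  · exact (partialSum_top c h).le

theorem composition_ext {c c' : Composition m n d} (h : ∀ a, partialSum c a = partialSum c' a) :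
    c = c' := by
  have key : ∀ (c : Composition m n d) (b : Fin (m + n + 1)),
      c.1 b = partialSum c b - if (b : ℕ) = 0 then 0 else partialSum c (b - 1) := by
    intro c b
    have : (Finset.univ.filter fun j : Fin (m + n + 1) => (j : ℕ) ≤ b) =
        insert b (Finset.univ.filter fun j : Fin (m + n + 1) => (j : ℕ) < b) := by
      ext j
      simp only [Finset.mem_filter, Finset.mem_univ, true_and, Finset.mem_insert, Fin.ext_iff]
      omega
    rw [partialSum, this, Finset.sum_insert (by simp)]
    split_ifs with hb
    · simp [hb]
    · have : (Finset.univ.filter fun j : Fin (m + n + 1) => (j : ℕ) < b) =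
          Finset.univ.filter fun j : Fin (m + n + 1) => (j : ℕ) ≤ (b : ℕ) - 1 := by
        ext j
        simp only [Finset.mem_filter, Finset.mem_univ, true_and]
        omega
      rw [this, partialSum, Nat.add_sub_cancel_right]
  refine Subtype.ext (funext fun b => ?_)
  rw [key c, key c', h, h]

/-- The dominant tuple `(0^{λ_0}, 1^{λ_1}, …, (m+n)^{λ_{m+n}})` of a composition: the entry at the
position `j` is the number of the partial sums, the last one excluded, that do not exceed `j`. -/
def dominantTuple (c : Composition m n d) : Fin d → Index m n := fun j =>
  ⟨(((Finset.range (m + n)).filter fun a => partialSum c a ≤ j).card : ℕ), by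
    have := Finset.card_filter_le (Finset.range (m + n)) (fun a => partialSum c a ≤ j)
    rw [Finset.card_range] at this
    simp only [Set.mem_Icc]
    omega⟩

theorem dominantTuple_nonneg (c : Composition m n d) (j : Fin d) : 0 ≤ (dominantTuple c j : ℤ) :=
  Int.natCast_nonneg _

/-- An initial segment of `{0, …, N - 1}` is determined by its number of elements. -/
theorem lt_card_filter_range {N : ℕ} {p : ℕ → Prop} [DecidablePred p]
    (hp : ∀ a b, a ≤ b → p b → p a) {a : ℕ} (ha : a < N) :
    a < ((Finset.range N).filter p).card ↔ p a := by
  constructor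
  · intro h
    by_contra hna
    have hsub : (Finset.range N).filter p ⊆ Finset.range a := by
      intro b hb
      rw [Finset.mem_filter] at hb
      rw [Finset.mem_range]
      by_contra hab
      exact hna (hp a b (by omega) hb.2)
    have := Finset.card_le_card hsub
    rw [Finset.card_range] at this
    omega
  · intro h
    have hsub : Finset.range (a + 1) ⊆ (Finset.range N).filter p := by
      intro b hb
      rw [Finset.mem_range] at hb
      rw [Finset.mem_filter, Finset.mem_range]
      exact ⟨by omega, hp b a (by omega) h⟩
    have := Finset.card_le_card hsub
    rw [Finset.card_range] at this
    omega

theorem dominantTuple_le_iff (c : Composition m n d) (j : Fin d) (a : ℕ) :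
    (dominantTuple c j : ℤ) ≤ a ↔ (j : ℕ) < partialSum c a := by
  by_cases ha : a < m + n
  · have := lt_card_filter_range (p := fun a => partialSum c a ≤ j)
      (fun a b hab h => (partialSum_mono c hab).trans h) ha
    simp only [dominantTuple]
    omega
  · rw [partialSum_top c (by omega)]
    have hb := (dominantTuple c j).2
    simp only [Set.mem_Icc] at hb
    have := j.2
    omega

theorem isDominant_dominantTuple (c : Composition m n d) : IsDominant (dominantTuple c) := by
  intro k
  have h0 := dominantTuple_nonneg c k
  by_cases hk : (k : ℕ) = 0
  · rw [leftEntry_zero hk, SymInt.coe_neg]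
    omega
  · rw [leftEntry_pos hk]
    obtain ⟨a, ha⟩ := Int.eq_ofNat_of_zero_le h0
    rw [ha]
    have h1 := (dominantTuple_le_iff c k a).mp ha.le
    refine (dominantTuple_le_iff c (prev k) a).mpr ?_
    simp only [prev]
    omega

theorem composition_dominantTuple (c : Composition m n d) : composition (dominantTuple c) = c := by
  refine composition_ext fun a => ?_
  rw [partialSum_composition]
  have : (Finset.univ.filter fun j : Fin d => (dominantTuple c j : ℤ).natAbs ≤ a) =
      Finset.univ.filter fun j : Fin d => (j : ℕ) < partialSum c a := by
    refine Finset.filter_congr fun j _ => ?_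
    rw [← dominantTuple_le_iff]
    have := dominantTuple_nonneg c j
    omega
  rw [this, Fin.card_filter_val_lt]
  exact min_eq_right (partialSum_le c a)

theorem IsDominant.nonneg {i : Fin d → Index m n} (hi : IsDominant i) (j : Fin d) :
    0 ≤ (i j : ℤ) := by
  obtain ⟨j, hj⟩ := j
  induction j with
  | zero =>
    have := hi ⟨0, hj⟩
    rw [leftEntry_zero rfl, SymInt.coe_neg] at this
    omega
  | succ j ih =>
    have := hi ⟨j + 1, hj⟩
    rw [leftEntry_pos (Nat.succ_ne_zero j)] at this
    exact (ih (by omega)).trans this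

theorem IsDominant.le_of_le {i : Fin d → Index m n} (hi : IsDominant i) {j k : ℕ} (hk : k < d)
    (hjk : j ≤ k) : (i ⟨j, hjk.trans_lt hk⟩ : ℤ) ≤ i ⟨k, hk⟩ := by
  induction k, hjk using Nat.le_induction with
  | base => exact le_rfl
  | succ k hjk ih =>
    have := hi ⟨k + 1, hk⟩
    rw [leftEntry_pos (Nat.succ_ne_zero k)] at this
    exact (ih (by omega)).trans this

theorem dominantTuple_composition {i : Fin d → Index m n} (hi : IsDominant i) :
    dominantTuple (composition i) = i := by
  have key : ∀ (j : Fin d) (a : ℕ),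
      (dominantTuple (composition i) j : ℤ) ≤ a ↔ (i j : ℤ) ≤ a := by
    intro j a
    rw [dominantTuple_le_iff, partialSum_composition]
    have h1 : (Finset.univ.filter fun j : Fin d => (i j : ℤ).natAbs ≤ a).card =
        ((Finset.range d).filter fun r => ∃ h : r < d, (i ⟨r, h⟩ : ℤ) ≤ a).card := by
      refine Finset.card_bij (fun j _ => (j : ℕ)) ?_ ?_ ?_
      · intro j hj
        simp only [Finset.mem_filter, Finset.mem_univ, true_and] at hj
        simp only [Finset.mem_filter, Finset.mem_range, j.2, true_and, exists_true_left,
          Fin.eta]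
        have := hi.nonneg j
        omega
      · intro j _ j' _ h
        exact Fin.ext h
      · intro r hr
        simp only [Finset.mem_filter, Finset.mem_range] at hr
        obtain ⟨hr, hr', h⟩ := hr
        refine ⟨⟨r, hr⟩, ?_, rfl⟩
        have := hi.nonneg ⟨r, hr⟩
        simp only [Finset.mem_filter, Finset.mem_univ, true_and]
        omega
    rw [h1, lt_card_filter_range _ j.2]
    · simp
    · rintro r s hrs ⟨hs, h⟩
      exact ⟨by omega, (hi.le_of_le hs hrs).trans h⟩
  refine funext fun j => Subtype.ext (le_antisymm ?_ ?_)
  · obtain ⟨a, ha⟩ := Int.eq_ofNat_of_zero_le (hi.nonneg j)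
    rw [ha]
    exact (key j a).mpr ha.le
  · obtain ⟨a, ha⟩ := Int.eq_ofNat_of_zero_le (dominantTuple_nonneg (composition i) j)
    rw [ha]
    exact (key j a).mp ha.le

/-- The simple reflections that fix the dominant tuple of `λ` are those of `W_λ`. -/
theorem leftEntry_dominantTuple_eq_iff (c : Composition m n d) (k : Fin d) :
    leftEntry (dominantTuple c) k = dominantTuple c k ↔ IsParabolicIndex c k := by
  have h0 := dominantTuple_nonneg c k
  have hb := (dominantTuple c k).2
  simp only [Set.mem_Icc] at hb
  obtain ⟨a, ha⟩ := Int.eq_ofNat_of_zero_le h0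
  rw [Subtype.ext_iff]
  by_cases hk : (k : ℕ) = 0
  · rw [leftEntry_zero hk, SymInt.coe_neg]
    have hz : (dominantTuple c k : ℤ) ≤ (0 : ℕ) ↔ (k : ℕ) < partialSum c 0 :=
      dominantTuple_le_iff c k 0
    constructor
    · intro h i hi hki
      have := hz.mp (by push_cast; omega)
      have := partialSum_mono c (Nat.zero_le i)
      omega
    · intro h
      by_cases hmn : 0 < m + n
      · have := h 0 hmn
        have := hz.mpr (by omega)
        push_cast at this
        omega
      · omega
  · rw [leftEntry_pos hk]
    have hp : ((prev k : Fin d) : ℕ) + 1 = k := by simp only [prev]; omega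
    constructor
    · intro h i hi hki
      have h1 := dominantTuple_le_iff c k i
      have h2 := dominantTuple_le_iff c (prev k) i
      rw [h] at h2
      omega
    · intro h
      have hle := isDominant_dominantTuple c k
      rw [leftEntry_pos hk] at hle
      refine le_antisymm hle ?_
      obtain ⟨b, hb'⟩ := Int.eq_ofNat_of_zero_le (dominantTuple_nonneg c (prev k))
      have h2 := (dominantTuple_le_iff c (prev k) b).mp hb'.le
      rw [hb']
      refine (dominantTuple_le_iff c k b).mpr ?_
      by_cases hbt : b < m + n
      · have := h b hbt
        omega
      · rw [partialSum_top c (by omega)]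
        exact k.2

theorem diagScalar_dominantTuple (c : Composition m n d) (k : Fin d) :
    diagScalar (dominantTuple c k) = if (k : ℕ) < partialSum c m then q else -1 := by
  have h0 := dominantTuple_nonneg c k
  have h1 := dominantTuple_le_iff c k m
  simp only [diagScalar, hat, abs_of_nonneg h0, h1]
  split_ifs <;> simp_all

theorem partialSum_ne_of_isParabolicIndex (c : Composition m n d) {k : Fin d}
    (hk : IsParabolicIndex c k) : (k : ℕ) ≠ partialSum c m := by
  by_cases hn : m < m + n
  · exact hk m hn
  · rw [partialSum_top c (by omega)]
    exact k.2.ne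

end Dominant

/-! ### The isomorphism of the tensor space with the sum of the modules `[xy]_λ ℋ` -/

section Comparison

variable {m n d : ℕ}

theorem composition_tupleAct (i : Fin d → Index m n) (k : Fin d) :
    composition (tupleAct i k) = composition i := by
  refine Subtype.ext (funext fun a => ?_)
  change (Finset.univ.filter fun j : Fin d => (tupleAct i k j : ℤ).natAbs = a).card =
    (Finset.univ.filter fun j : Fin d => (i j : ℤ).natAbs = a).card
  by_cases hk : (k : ℕ) = 0
  · refine congrArg Finset.card (Finset.filter_congr fun j _ => ?_)
    rw [tupleAct_zero hk]
    by_cases hj : j = k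
    · subst hj
      rw [Function.update_self, SymInt.coe_neg, Int.natAbs_neg]
    · rw [Function.update_of_ne hj]
  · rw [tupleAct_pos hk]
    exact Finset.card_equiv (Equiv.swap (prev k) k) (fun j => by simp)

/-- The number of the odd entries of a tuple is the size of the odd part of its composition. -/
theorem sum_hat_eq_oddSize (i : Fin d → Index m n) :
    ∑ k, hat (i k) = oddSize (composition i) := by
  have h1 : partialSum (composition i) m + oddSize (composition i) = d := by
    have := Finset.sum_filter_add_sum_filter_not (Finset.univ : Finset (Fin (m + n + 1)))
      (fun j => (j : ℕ) ≤ m) (composition i).1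
    rw [(composition i).2] at this
    simp only [not_le] at this
    exact this
  have h2 : (Finset.univ.filter fun j : Fin d => (i j : ℤ).natAbs ≤ m).card +
      (Finset.univ.filter fun j : Fin d => ¬ (i j : ℤ).natAbs ≤ m).card = d := by
    rw [Finset.card_filter_add_card_filter_not, Finset.card_univ, Fintype.card_fin]
  have h3 : ∑ k, hat (i k) = (Finset.univ.filter fun j : Fin d => ¬ (i j : ℤ).natAbs ≤ m).card := by
    rw [Finset.card_filter]
    refine Finset.sum_congr rfl fun j _ => ?_
    unfold hat
    rw [Int.abs_eq_natAbs]
    split_ifs <;> omega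
  rw [partialSum_composition] at h1
  omega

theorem op_heckeGen_smul_dominant (c : Composition m n d) {k : Fin d} (hk : IsParabolicIndex c k) :
    MulOpposite.op (heckeGen k) • boldBasis m n d (dominantTuple c) =
      (if (k : ℕ) < partialSum c m then q else -1) • boldBasis m n d (dominantTuple c) := by
  rw [heckeGen_smul_of_eq ((leftEntry_dominantTuple_eq_iff c k).mpr hk), diagScalar_dominantTuple]

/-- The generator `[xy]_λ` of the summand `[xy]_λ ℋ`. -/
noncomputable def xyGen (c : Composition m n d) : xyIdeal c :=
  ⟨xyElt c, Submodule.mem_span_singleton_self _⟩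

theorem op_heckeGen_smul_xyGen (c : Composition m n d) {k : Fin d} (hk : IsParabolicIndex c k) :
    MulOpposite.op (heckeGen k) • xyGen c =
      (if (k : ℕ) < partialSum c m then q else -1) • xyGen c := by
  apply Subtype.ext
  change xyElt c * heckeGen k = (if (k : ℕ) < partialSum c m then q else -1) • xyElt c
  rcases lt_or_gt_of_ne (partialSum_ne_of_isParabolicIndex c hk) with h | h
  · rw [if_pos h, xyElt_mul_heckeGen_even c hk h]
  · rw [if_neg h.not_gt, xyElt_mul_heckeGen_odd c hk h, neg_smul, one_smul]

open Classical in
/-- The vector `[xy]_λ` of the summand with the index `λ`. -/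
noncomputable def permGen (c : Composition m n d) : PermModule m n d :=
  DirectSum.lof (Hecke d)ᵐᵒᵖ _ (fun c : Composition m n d => xyIdeal c) c (xyGen c)

theorem op_heckeGen_smul_permGen (c : Composition m n d) {k : Fin d} (hk : IsParabolicIndex c k) :
    MulOpposite.op (heckeGen k) • permGen c =
      (if (k : ℕ) < partialSum c m then q else -1) • permGen c := by
  rw [permGen, ← map_smul, op_heckeGen_smul_xyGen c hk, LinearMap.map_smul_of_tower]

/-- The homomorphism `V_{m|n}^{⊗ d} → ⨁_λ [xy]_λ ℋ` given by the universal property. -/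
theorem exists_toPermModule :
    ∃ F : TensorSpace m n d →ₗ[(Hecke d)ᵐᵒᵖ] PermModule m n d,
      ∀ c, F (boldBasis m n d (dominantTuple c)) = permGen c := by
  obtain ⟨F, hF⟩ := exists_heckeHom (N := PermModule m n d) (m := m) (n := n)
    (fun i => permGen (composition i)) (by
      intro i hi k hk
      have hi' := dominantTuple_composition hi
      rw [rightGen_apply]
      rw [← hi'] at hk
      rw [op_heckeGen_smul_permGen _ ((leftEntry_dominantTuple_eq_iff _ k).mp hk),
        ← diagScalar_dominantTuple, hi'])
  exact ⟨F, fun c => by rw [hF _ (isDominant_dominantTuple c), composition_dominantTuple]⟩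

/-- The homomorphism `⨁_λ [xy]_λ ℋ → V_{m|n}^{⊗ d}` that maps `h` in the summand of `λ` to
`𝐞_{𝐢_λ} h`, where `𝐢_λ` is the dominant tuple of `λ`. -/
noncomputable def fromPermModule : PermModule m n d →ₗ[(Hecke d)ᵐᵒᵖ] TensorSpace m n d := by
  classical
  exact DirectSum.toModule (Hecke d)ᵐᵒᵖ _ _ fun c =>
    { toFun := fun x => MulOpposite.op (x : Hecke d) • boldBasis m n d (dominantTuple c)
      map_add' := fun x y => by rw [Submodule.coe_add, MulOpposite.op_add, add_smul]
      map_smul' := fun h x => by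
        rw [Submodule.coe_smul, RingHom.id_apply, smul_smul]
        rfl }

/-- The vectors `𝐞_{𝐢}`, `𝐢` dominant, generate `V_{m|n}^{⊗ d}` under `ℋ`; hence a homomorphism
that multiplies them by scalars depending on their composition does so with all `𝐞_𝐢`. -/
theorem apply_boldBasis_of_dominant {g : TensorSpace m n d →ₗ[(Hecke d)ᵐᵒᵖ] TensorSpace m n d}
    {a : Composition m n d → Laurent}
    (hg : ∀ c, g (boldBasis m n d (dominantTuple c)) = a c • boldBasis m n d (dominantTuple c))
    (i : Fin d → Index m n) :
    g (boldBasis m n d i) = a (composition i) • boldBasis m n d i := by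
  induction i using tuple_induction with
  | dominant i hi =>
    have := hg (composition i)
    rwa [dominantTuple_composition hi] at this
  | step i k hk ih =>
    rw [boldBasis_eq_of_gt hk, LinearMap.map_smul_of_tower, map_smul, ih, composition_tupleAct,
      smul_comm _ (a _), smul_comm _ (a _)]

/-- `V_{m|n}^{⊗ d}` and `⨁_λ [xy]_λ ℋ` are isomorphic. The homomorphism given by the universal
property is surjective since its image contains the generators `[xy]_λ`. It is injective since its
composite with `fromPermModule` multiplies each `𝐞_𝐢` by a nonzero scalar. -/
theorem exists_permModule_equiv :
    ∃ Φ : TensorSpace m n d ≃ₗ[(Hecke d)ᵐᵒᵖ] PermModule m n d,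
      ∀ c, Φ (boldBasis m n d (dominantTuple c)) = permGen c := by
  classical
  obtain ⟨F, hF⟩ := exists_toPermModule (m := m) (n := n) (d := d)
  have hscalar : ∀ c : Composition m n d, ∃ a : Laurent, a ≠ 0 ∧
      MulOpposite.op (xyElt c) • boldBasis m n d (dominantTuple c) =
        a • boldBasis m n d (dominantTuple c) := fun c =>
    exists_op_xyElt_smul c _
      (fun k hk h => by rw [op_heckeGen_smul_dominant c hk, if_pos h])
      (fun k hk h => by rw [op_heckeGen_smul_dominant c hk, if_neg h.not_gt])
  choose a ha0 ha using hscalar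
  have hcomp : ∀ i, fromPermModule (F (boldBasis m n d i)) =
      a (composition i) • boldBasis m n d i := by
    refine apply_boldBasis_of_dominant (g := fromPermModule ∘ₗ F) fun c => ?_
    rw [LinearMap.comp_apply, hF, permGen, fromPermModule, DirectSum.toModule_lof]
    exact ha c
  have hrepr : ∀ x i, (boldBasis m n d).repr (fromPermModule (F x)) i =
      a (composition i) * (boldBasis m n d).repr x i := by
    intro x i
    have hlin : (Finsupp.lapply i ∘ₗ (boldBasis m n d).repr.toLinearMap) ∘ₗ
        ((fromPermModule ∘ₗ F).restrictScalars Laurent) =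
        a (composition i) • (Finsupp.lapply i ∘ₗ (boldBasis m n d).repr.toLinearMap) := by
      refine (boldBasis m n d).ext fun j => ?_
      simp only [LinearMap.comp_apply, LinearMap.restrictScalars_apply, hcomp, map_smul,
        LinearEquiv.coe_coe, Module.Basis.repr_self, LinearMap.smul_apply, Finsupp.lapply_apply]
      by_cases h : j = i
      · rw [h]
      · simp [h]
    exact LinearMap.congr_fun hlin x
  have hinj : Function.Injective F := by
    rw [injective_iff_map_eq_zero]
    intro x hx
    apply (boldBasis m n d).repr.injective
    ext1 i
    have := hrepr x i
    rw [hx, map_zero, map_zero, Finsupp.zero_apply, eq_comm, mul_eq_zero] at this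
    rw [this.resolve_left (ha0 _), map_zero, Finsupp.zero_apply]
  have hsurj : Function.Surjective F := by
    rw [← LinearMap.range_eq_top, eq_top_iff]
    rintro y -
    induction y using DirectSum.induction_on with
    | zero => exact Submodule.zero_mem _
    | of c x =>
      obtain ⟨h, hh⟩ := Submodule.mem_span_singleton.mp x.2
      have hx : x = h • xyGen c := Subtype.ext hh.symm
      refine ⟨h • boldBasis m n d (dominantTuple c), ?_⟩
      rw [map_smul, hF, permGen, ← map_smul, ← hx]
      rfl
    | add x y hx hy => exact Submodule.add_mem _ hx hy
  exact ⟨LinearEquiv.ofBijective F ⟨hinj, hsurj⟩, hF⟩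

end Comparison

/-! ### The gradings -/

/-- A ring with a complete family of orthogonal idempotents `e_r` indexed by an abelian group is
graded: the part of degree `p` consists of the elements that map the part `r` to the part
`r + p`. -/
theorem nonempty_gradedAlgebra {ι A R : Type*} [AddCommGroup ι] [Fintype ι] [DecidableEq ι]
    [CommSemiring A] [Semiring R] [Algebra A R] (e : ι → R)
    (hidem : ∀ r s, e r * e s = if r = s then e r else 0) (hsum : ∑ r, e r = 1)
    (E : ι → Submodule A R) (hE : ∀ p f, f ∈ E p ↔ ∀ r, e (r + p) * f * e r = f * e r) :
    Nonempty (GradedAlgebra E) := by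
  have hcoe : ∀ f, ∑ p, ∑ r, e (r + p) * f * e r = f := by
    intro f
    rw [Finset.sum_comm]
    have : ∀ r, ∑ p, e (r + p) * f * e r = f * e r := by
      intro r
      have h1 : ∑ p, e (r + p) = 1 := (Equiv.sum_comp (Equiv.addLeft r) e).trans hsum
      rw [← Finset.sum_mul, ← Finset.sum_mul, h1, one_mul]
    rw [Finset.sum_congr rfl fun r _ => this r, ← Finset.mul_sum, hsum, mul_one]
  let proj : (p : ι) → R →ₗ[A] E p := fun p =>
    LinearMap.codRestrict (E p)
      (∑ r, LinearMap.mulRight A (e r) ∘ₗ LinearMap.mulLeft A (e (r + p))) fun f => by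
        rw [hE]
        intro s
        simp only [LinearMap.sum_apply, LinearMap.comp_apply, LinearMap.mulLeft_apply,
          LinearMap.mulRight_apply]
        have : (∑ r, e (r + p) * f * e r) * e s = e (s + p) * f * e s := by
          rw [Finset.sum_mul, Finset.sum_eq_single s]
          · rw [mul_assoc, hidem, if_pos rfl]
          · intro r _ hr
            rw [mul_assoc, hidem, if_neg hr, mul_zero]
          · simp
        rw [mul_assoc, this, ← mul_assoc, ← mul_assoc, hidem, if_pos rfl]
  have hproj : ∀ p f, (proj p f : R) = ∑ r, e (r + p) * f * e r := fun p f => by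
    simp [proj]
  have hpiece : ∀ s p (f : E s), (proj p f : R) = if p = s then (f : R) else 0 := by
    intro s p f
    have hf := (hE s f).mp f.2
    have hterm : ∀ r, e (r + p) * (f : R) * e r = if p = s then (f : R) * e r else 0 := by
      intro r
      rw [mul_assoc, ← hf r, ← mul_assoc, ← mul_assoc, hidem]
      by_cases h : p = s
      · subst h
        simp only [if_true]
      · rw [if_neg (by simpa using h), if_neg h, zero_mul, zero_mul]
    rw [hproj, Finset.sum_congr rfl fun r _ => hterm r]
    split_ifs
    · rw [← Finset.mul_sum, hsum, mul_one]
    · simp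
  exact ⟨{
    one_mem := by
      rw [hE]
      intro r
      rw [add_zero, mul_one, one_mul, hidem, if_pos rfl]
    mul_mem := by
      intro p s f g hf hg
      rw [hE] at hf hg ⊢
      intro r
      rw [show r + (p + s) = r + s + p by abel, mul_assoc, mul_assoc, ← hg r,
        ← mul_assoc f, ← mul_assoc f, ← hf (r + s)]
      simp only [← mul_assoc, hidem, if_true]
    toDecomposition := DirectSum.Decomposition.ofLinearMap E
      (∑ p, DirectSum.lof A ι (fun p => E p) p ∘ₗ proj p)
      (by
        refine LinearMap.ext fun f => ?_
        simp only [LinearMap.comp_apply, LinearMap.sum_apply, map_sum,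
          DirectSum.coeLinearMap_lof, hproj, hcoe, LinearMap.id_apply])
      (by
        refine DirectSum.linearMap_ext A fun s => LinearMap.ext fun f => ?_
        simp only [LinearMap.comp_apply, LinearMap.sum_apply, DirectSum.coeLinearMap_lof,
          LinearMap.id_apply]
        rw [Finset.sum_eq_single s]
        · congr 1
          exact Subtype.ext (by rw [hpiece, if_pos rfl])
        · intro p _ hp
          have : proj p (f : R) = 0 := Subtype.ext (by rw [hpiece, if_neg hp]; rfl)
          rw [this, map_zero]
        · simp) }⟩

section Grading

variable {m n d : ℕ}

/-- The projection of `⨁_λ [xy]_λ ℋ` to the sum of the summands with `|λ⁽¹⁾| ≡ r` modulo `2`. -/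
noncomputable def parityProj (m n d : ℕ) (r : ZMod 2) : SchurSuperalgebra m n d :=
  DFinsupp.filterLinearMap (Hecke d)ᵐᵒᵖ (fun c : Composition m n d => xyIdeal c)
    (fun c => ((oddSize c : ℕ) : ZMod 2) = r)

theorem parityProj_apply (r : ZMod 2) (x : PermModule m n d) (c : Composition m n d) :
    parityProj m n d r x c = if ((oddSize c : ℕ) : ZMod 2) = r then x c else 0 :=
  DFinsupp.filter_apply _ _ _

theorem parityProj_mul (r s : ZMod 2) :
    parityProj m n d r * parityProj m n d s = if r = s then parityProj m n d r else 0 := by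
  refine LinearMap.ext fun x => DFinsupp.ext fun c => ?_
  change parityProj m n d r (parityProj m n d s x) c = _
  rw [parityProj_apply, parityProj_apply]
  by_cases h : r = s
  · subst h
    rw [if_pos rfl, parityProj_apply]
    split_ifs <;> rfl
  · rw [if_neg h]
    change _ = (0 : xyIdeal c)
    split_ifs with h1 h2
    · exact absurd (h1.symm.trans h2) h
    · rfl
    · rfl

theorem sum_parityProj : ∑ r, parityProj m n d r = 1 := by
  refine LinearMap.ext fun x => DFinsupp.ext fun c => ?_
  rw [LinearMap.sum_apply]
  change (DirectSum.component (Hecke d)ᵐᵒᵖ _ _ c) (∑ r, parityProj m n d r x) = x c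
  rw [map_sum]
  change ∑ r, parityProj m n d r x c = x c
  simp only [parityProj_apply, Finset.sum_ite_eq, Finset.mem_univ, if_true]

theorem zmod_two_add_eq_iff (a b p : ZMod 2) : a + b = p ↔ b = a + p := by
  revert a b p; decide

theorem mem_schurGrading_iff (p : ZMod 2) (f : SchurSuperalgebra m n d) :
    f ∈ schurGrading m n d p ↔
      ∀ r, parityProj m n d (r + p) * f * parityProj m n d r = f * parityProj m n d r := by
  classical
  have hlof : ∀ r c (x : xyIdeal c), parityProj m n d r
      (DirectSum.lof (Hecke d)ᵐᵒᵖ _ (fun c : Composition m n d => xyIdeal c) c x) =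
      if ((oddSize c : ℕ) : ZMod 2) = r then
        DirectSum.lof (Hecke d)ᵐᵒᵖ _ (fun c : Composition m n d => xyIdeal c) c x else 0 := by
    intro r c x
    exact DFinsupp.filter_single _ _ _
  constructor
  · intro hf r
    refine DirectSum.linearMap_ext _ fun c => LinearMap.ext fun x => ?_
    simp only [LinearMap.comp_apply, Module.End.mul_apply, hlof]
    by_cases hc : ((oddSize c : ℕ) : ZMod 2) = r
    · rw [if_pos hc]
      refine DFinsupp.ext fun c' => ?_
      refine (parityProj_apply _ _ _).trans ?_
      by_cases hc' : ((oddSize c' : ℕ) : ZMod 2) = r + p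
      · rw [if_pos hc']
      · rw [if_neg hc']
        refine (Eq.trans ?_ (hf c c' ?_ x)).symm
        · convert rfl
        · push_cast
          rw [hc]
          exact fun h => hc' ((zmod_two_add_eq_iff _ _ _).mp h)
    · rw [if_neg hc, map_zero, map_zero]
  · intro h c c' hcc' x
    have := LinearMap.congr_fun (h (oddSize c : ZMod 2))
      (DirectSum.lof (Hecke d)ᵐᵒᵖ _ (fun c : Composition m n d => xyIdeal c) c x)
    simp only [Module.End.mul_apply, hlof, if_true] at this
    have h2 := congrArg (fun y : PermModule m n d => y c') this
    simp only at h2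
    rw [parityProj_apply, if_neg] at h2
    · refine Eq.trans ?_ h2.symm
      convert rfl
    · intro h3
      refine hcc' ?_
      push_cast
      exact (zmod_two_add_eq_iff _ _ _).mpr h3

theorem boldBasis_mem_tensorGrading (i : Fin d → Index m n) :
    boldBasis m n d i ∈ tensorGrading m n d (oddSize (composition i)) := by
  rw [boldBasis, Module.Basis.unitsSMul_apply]
  refine Submodule.smul_mem _ _ (Submodule.subset_span ⟨i, ?_, rfl⟩)
  rw [sum_hat_eq_oddSize]

/-- The transport of `parityProj` to `V_{m|n}^{⊗ d}` projects to the homogeneous parts of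
`V_{m|n}^{⊗ d}`. -/
theorem mem_tensorGrading_iff (Φ : TensorSpace m n d ≃ₗ[(Hecke d)ᵐᵒᵖ] PermModule m n d)
    (hΦ : ∀ c, Φ (boldBasis m n d (dominantTuple c)) = permGen c) (r : ZMod 2)
    (x : TensorSpace m n d) :
    x ∈ tensorGrading m n d r ↔
      Φ.symm.conjAlgEquiv Laurent (parityProj m n d r) x = x := by
  classical
  set P := Φ.symm.conjAlgEquiv Laurent (parityProj m n d r)
  have hbold : ∀ i, P (boldBasis m n d i) =
      (if ((oddSize (composition i) : ℕ) : ZMod 2) = r then (1 : Laurent) else 0) •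
        boldBasis m n d i := by
    refine apply_boldBasis_of_dominant
      (a := fun c => if ((oddSize c : ℕ) : ZMod 2) = r then (1 : Laurent) else 0) fun c => ?_
    change Φ.symm (parityProj m n d r (Φ (boldBasis m n d (dominantTuple c)))) = _
    have hgen : parityProj m n d r (permGen c) =
        if ((oddSize c : ℕ) : ZMod 2) = r then permGen c else 0 := DFinsupp.filter_single _ _ _
    rw [hΦ, hgen]
    split_ifs
    · rw [one_smul, ← hΦ, LinearEquiv.symm_apply_apply]
    · rw [zero_smul, map_zero]
  constructor
  · intro hx
    induction hx using Submodule.span_induction with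
    | mem x hx =>
      obtain ⟨i, hi, rfl⟩ := hx
      have hb : tensorBasis m n d i =
          (((vUnit ^ tupleLength i)⁻¹ : Laurentˣ) : Laurent) • boldBasis m n d i := by
        rw [boldBasis, Module.Basis.unitsSMul_apply, Units.smul_def, smul_smul, Units.inv_mul,
          one_smul]
      rw [sum_hat_eq_oddSize] at hi
      rw [hb, LinearMap.map_smul_of_tower, hbold, if_pos hi, one_smul]
    | zero => exact map_zero _
    | add x y _ _ hx hy => rw [map_add, hx, hy]
    | smul a x _ hx => rw [LinearMap.map_smul_of_tower, hx]
  · intro hx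
    rw [← hx]
    have : ∀ y : TensorSpace m n d, P y ∈ tensorGrading m n d r := by
      intro y
      induction (boldBasis m n d).mem_span y using Submodule.span_induction with
      | mem x hx =>
        obtain ⟨i, rfl⟩ := hx
        rw [hbold]
        split_ifs with h
        · rw [one_smul, ← h]
          exact boldBasis_mem_tensorGrading i
        · rw [zero_smul]
          exact Submodule.zero_mem _
      | zero => rw [map_zero]; exact Submodule.zero_mem _
      | add x y _ _ hx hy => rw [map_add]; exact Submodule.add_mem _ hx hy
      | smul a x _ hx => rw [LinearMap.map_smul_of_tower]; exact Submodule.smul_mem _ a hx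
    exact this x

end Grading

end IotaSchur

open IotaSchur in
theorem corollary2p14 (m n d : ℕ) (hd : 0 < d) :
    Nonempty (GradedAlgebra (schurGrading m n d)) ∧
    Nonempty (GradedAlgebra (tensorEndGrading m n d)) ∧
    ∃ ψ : SchurSuperalgebra m n d ≃ₐ[Laurent] TensorEnd m n d,
      ∀ p : ZMod 2, (schurGrading m n d p).map ψ.toLinearMap = tensorEndGrading m n d p := by
  obtain ⟨ψ, hmem⟩ : ∃ ψ : SchurSuperalgebra m n d ≃ₐ[Laurent] TensorEnd m n d,
      ∀ r x, x ∈ tensorGrading m n d r ↔ ψ (parityProj m n d r) x = x := by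
    obtain ⟨Φ, hΦ⟩ := exists_permModule_equiv (m := m) (n := n) (d := d)
    exact ⟨Φ.symm.conjAlgEquiv Laurent, mem_tensorGrading_iff Φ hΦ⟩
  have hmul : ∀ r s, ψ (parityProj m n d r) * ψ (parityProj m n d s) =
      if r = s then ψ (parityProj m n d r) else 0 := by
    intro r s
    rw [← map_mul, parityProj_mul]
    split_ifs
    · rfl
    · exact map_zero ψ
  have hsum : ∑ r, ψ (parityProj m n d r) = 1 := by rw [← map_sum, sum_parityProj, map_one]
  have hE : ∀ p f, f ∈ tensorEndGrading m n d p ↔ ∀ r, ψ (parityProj m n d (r + p)) * f *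
      ψ (parityProj m n d r) = f * ψ (parityProj m n d r) := by
    intro p f
    constructor
    · intro hf r
      refine LinearMap.ext fun x => ?_
      refine (hmem _ _).mp (hf r _ ((hmem _ _).mpr ?_))
      have := LinearMap.congr_fun (hmul r r) x
      rwa [if_pos rfl] at this
    · intro h r x hx
      rw [hmem] at hx ⊢
      have := LinearMap.congr_fun (h r) x
      simp only [Module.End.mul_apply] at this
      rwa [hx] at this
  refine ⟨nonempty_gradedAlgebra _ parityProj_mul sum_parityProj _ mem_schurGrading_iff,
    nonempty_gradedAlgebra _ hmul hsum _ hE, ψ, fun p => ?_⟩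
  ext f
  rw [Submodule.mem_map]
  constructor
  · rintro ⟨g, hg, rfl⟩
    rw [mem_schurGrading_iff] at hg
    rw [hE]
    intro r
    have := congrArg ψ (hg r)
    rwa [map_mul, map_mul, map_mul] at this
  · intro hf
    refine ⟨ψ.symm f, ?_, ψ.apply_symm_apply f⟩
    rw [mem_schurGrading_iff]
    intro r
    apply ψ.injective
    rw [map_mul, map_mul, map_mul, ψ.apply_symm_apply]
    exact (hE p f).mp hf r
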